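/- **Setting.** Label individuals by finite sequences of natural numbers, the root $\phi$ being the empty sequence. Let $h=\{h_i: i\ge 0\}$ be a probability law on $\{0,1,2,\dots\}$ and $\nu$ a probability law on $\mathbb{R}$. Under $\mathbb{P}_{h,\nu}$, $T$ is the rooted ordered Galton-Watson tree with offspring law $h$, and, independently of the tree, its edges $e$ carry independent biases $\beta_e$ with law $\nu$. For a vertex $v \in V(T)$, let $\omega(v)$ be the product of the biases of the edges on the path from $\phi$ to $v$ (so $\omega(\phi)=1$), and let $\omega(T)=\sum_{v\in V(T)}\omega(v)$. For $u>0$, put $\mathbb{P}_{h,\nu,u}=\mathbb{P}_{h,\nu}(\,\cdot\mid \omega(T)>u)$. Let $D(T)$ be the depth of $T$ (the greatest distance of a vertex from $\phi$), and let $v_{\rm base}$ be the lexicographically minimal vertex at depth $D(T)$. Let $\phi=\psi_0,\psi_1,\dots,\psi_{D(T)}=v_{\rm base}$ be the successive vertices of the path from $\phi$ to $v_{\rm base}$. For $0\le i\le D(T)$, the $i$-th outgrowth $J_i$ is the connected component containing $\psi_i$ of the graph obtained from $T$ by deleting the edges of this path; for $i>D(T)$, $J_i=\emptyset$. **Theorem.**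 Suppose that $h_0<1$, that $\sum_{k\ge 1}k h_k<1$, and that there is $c_0>0$ with $\sum_{l\ge k}h_l\le \exp\{-c_0k\}$ for every $k\in\mathbb{N}$. Suppose that the support of $\nu$ is a compact subset of $(1,\infty)$. Let $m\ge 1$ be the least positive integer with $h_m>0$. Then there exists $c>0$, depending only on $h$ and $\nu$, such that for all $u>0$, all integers $i\ge 0$, and all integers $k>m$, $$\mathbb{P}_{h,\nu,u}\big(|V(J_i)|\ge k\big)\le \exp\{-ck\}.$$ -/

import Mathlib

open MeasureTheory ProbabilityTheory
open scoped ENNReal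

noncomputable section

open scoped Classical

/-- Labels of individuals: finite sequences of natural numbers, `[]` being the root. The children of
`u` are `u ++ [0]`, `u ++ [1]`, …, and the parent of `u ≠ []` is `u.dropLast`. The linear order that
Mathlib puts on `List ℕ` is the lexicographical one. -/
abbrev Label := List ℕ

/-- A finite rooted ordered tree, coded by labels, with a bias on each edge. The edge joining a
vertex `u ≠ []` to its parent carries the bias `bias u`; other values of `bias` are irrelevant. -/
structure WeightedTree where
  verts : Finset Label
  root_mem : [] ∈ verts
  parent_mem : ∀ u ∈ verts, u ≠ [] → u.dropLast ∈ verts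
  children : ∀ u ∈ verts, ∃ n : ℕ, ∀ j : ℕ, u ++ [j] ∈ verts ↔ j < n
  bias : Label → ℝ

namespace WeightedTree

variable (T : WeightedTree)

/-- The tree as a graph: each vertex other than the root is joined to its parent.
(Labels that are not vertices of the tree are isolated.) -/
def graph : SimpleGraph Label where
  Adj u v := u ∈ T.verts ∧ v ∈ T.verts ∧
    ((v ≠ [] ∧ u = v.dropLast) ∨ (u ≠ [] ∧ v = u.dropLast))
  symm := ⟨fun _ _ h => ⟨h.2.1, h.1, h.2.2.symm⟩⟩
  loopless := ⟨fun u h => by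
    have key : u ≠ [] → u ≠ u.dropLast := fun hu he => by
      have h1 := congrArg List.length he
      have h2 := List.length_pos_iff.mpr hu
      rw [List.length_dropLast] at h1
      omega
    rcases h.2.2 with ⟨hu, he⟩ | ⟨hu, he⟩ <;> exact key hu he⟩

/-- `ω(v)`: the product of the biases along the path from the root to `v`, whose non-root vertices
are `v.take 1, v.take 2, …, v.take v.length = v`. -/
def vertexWeight (v : Label) : ℝ :=
  ∏ j ∈ Finset.range v.length, T.bias (v.take (j + 1))

/-- `ω(T)`: the sum of `ω(v)` over the vertices of the tree. -/
def weight : ℝ := ∑ v ∈ T.verts, T.vertexWeight v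

/-- `D(T)`: the depth of the tree. -/
def depth : ℕ := T.verts.sup List.length

theorem deepest_nonempty : (T.verts.filter fun v => v.length = T.depth).Nonempty := by
  obtain ⟨v, hv, h⟩ := Finset.exists_mem_eq_sup T.verts ⟨[], T.root_mem⟩ List.length
  exact ⟨v, Finset.mem_filter.2 ⟨hv, h.symm⟩⟩

/-- `v_base`: the lexicographically minimal vertex of maximal depth. -/
def vBase : Label :=
  (T.verts.filter fun v => v.length = T.depth).min' T.deepest_nonempty

/-- `ψ_i`: the `i`-th vertex, for `0 ≤ i ≤ D(T)`, on the path from the root to `v_base`. -/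
def psi (i : ℕ) : Label := T.vBase.take i

/-- The edges of the path from the root to `v_base`. -/
def spineEdges : Set (Sym2 Label) :=
  {e | ∃ i : ℕ, i < T.depth ∧ e = s(T.psi i, T.psi (i + 1))}

/-- `V(J_i)`: the vertex set of the `i`-th outgrowth, that is, of the connected component of `ψ_i`
once the edges of the path from the root to `v_base` are deleted; it is empty for `i > D(T)`. -/
def outgrowth (i : ℕ) : Finset Label :=
  if i ≤ T.depth then
    T.verts.filter fun v => (T.graph.deleteEdges T.spineEdges).Reachable (T.psi i) v
  else ∅

end WeightedTree

/-- The vertex set of the Galton-Watson tree in which the individual `u` has `K u` children: the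
labels each of whose entries is less than the number of children of the individual before it. -/
def gwVerts (K : Label → ℕ) : Set Label :=
  {u | ∀ (j : ℕ) (hj : j < u.length), u[j] < K (u.take j)}

theorem nil_mem_gwVerts (K : Label → ℕ) : [] ∈ gwVerts K := by
  intro j hj
  simp at hj

theorem append_mem_gwVerts (K : Label → ℕ) (u : Label) (j : ℕ) :
    u ++ [j] ∈ gwVerts K ↔ u ∈ gwVerts K ∧ j < K u := by
  constructor
  · intro h
    refine ⟨fun i hi => ?_, ?_⟩
    · have := h i (by simp; omega)
      rwa [List.getElem_append_left hi, List.take_append_of_le_length hi.le] at this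
    · have := h u.length (by simp)
      simpa using this
  · rintro ⟨h, hj⟩ i hi
    rcases lt_or_ge i u.length with hlt | hge
    · rw [List.getElem_append_left hlt, List.take_append_of_le_length hlt.le]
      exact h i hlt
    · have : i = u.length := by simp at hi; omega
      subst this
      simpa using hj

/-- The weighted Galton-Watson tree built from numbers of children `e.1` and biases `e.2`.
On the event, of probability zero for a subcritical offspring law, that the Galton-Watson tree is
infinite, it is given the value of the tree with one vertex. -/
def gwTree (e : (Label → ℕ) × (Label → ℝ)) : WeightedTree :=
  if hfin : (gwVerts e.1).Finite then
    { verts := hfin.toFinset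
      root_mem := by simpa using nil_mem_gwVerts e.1
      parent_mem := fun u hu hne => by
        simp only [Set.Finite.mem_toFinset] at hu ⊢
        rw [← List.dropLast_append_getLast hne, append_mem_gwVerts] at hu
        exact hu.1
      children := fun u hu => ⟨e.1 u, fun j => by
        simp only [Set.Finite.mem_toFinset] at hu ⊢
        rw [append_mem_gwVerts]
        exact and_iff_right hu⟩
      bias := e.2 }
  else
    { verts := {[]}
      root_mem := by simp
      parent_mem := fun u hu hne => absurd (by simpa using hu) hne
      children := fun u _ => ⟨0, fun j => by simp⟩
      bias := e.2 }

/-- `ℙ_{h,ν}`: the numbers of children of the individuals are independent with law `h`, the biases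
are independent with law `ν`, and the two families are independent of each other. -/
def gwLaw (h : PMF ℕ) (ν : Measure ℝ) : Measure ((Label → ℕ) × (Label → ℝ)) :=
  (Measure.infinitePi fun _ : Label => h.toMeasure).prod (Measure.infinitePi fun _ : Label => ν)

/-- `ℙ_{h,ν,u}`: the law `ℙ_{h,ν}` conditioned on `ω(T) > u`. -/
def gwCondLaw (h : PMF ℕ) (ν : Measure ℝ) (u : ℝ) : Measure ((Label → ℕ) × (Label → ℝ)) :=
  ProbabilityTheory.cond (gwLaw h ν) {e | u < (gwTree e).weight}

/-- The hypothesis on the offspring law: it is subcritical and has an exponentially decaying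
tail. -/
structure SubcriticalExpTail (h : PMF ℕ) : Prop where
  mean_lt_one : ∑' k : ℕ, (k : ℝ≥0∞) * h k < 1
  exp_tail : ∃ c : ℝ, 0 < c ∧
    ∀ k : ℕ, ∑' l : Set.Ici k, h l ≤ ENNReal.ofReal (Real.exp (-c * k))

end

/-!
Write `F(u, s) = ℙ(ω(T) > u, D(T) ≥ s)`. The theorem is the case `s = 0` of the inequality
`exp (c k) ℙ(ω(T) > u, D(T) ≥ s, |V(J_i)| ≥ k) ≤ F(u, s)` for all `u`, `s`, `i` and all `k > m`. The
depth is added to the conditioning in order to make room for an induction on `i`: condition on the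
number of children of the root, on which child the path to the base vertex passes through, on all
the biases at the root and on the trees of the other children. The tree of the spine child is then
an independent copy of `T`, about which one knows that it is deep enough to be the first deepest
one and heavy enough to push the total weight above `u`, and `J_{i+1}` is its `i`-th
outgrowth. So the inequality passes from `i` to `i + 1` with the same constant
(`Dominated.of_spine_child`, `dominated_og`).

For `i = 0` there are three ingredients.

* *Planting.* If the root has `m` children of which only the first has a progeny, the
  weight is at least `q` times that of the tree of this child, where `q > 1` is the least possible
  bias. Hence lowering `u` by a factor `y` costs `F(u, s)` a factor which is only polynomial in `y`
  (`exists_measure_mul_wt_le`). Moreover `|V(J_0)| ≤ m` for such trees, which bounds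
  `ℙ(|V(J_0)| > m | ω(T) > u, D(T) ≥ s)` away from `1` (`measure_plant_le`).
* *Grafting.* A heavy tree of depth `d` extended below its base vertex by an independent tree is
  heavy and deeper (`dominated_graft`). Since depth `d` costs `(mean) ^ d`, two independent trees,
  one heavy and of depth at least `t` and the other even deeper, are exponentially in `t` less
  likely than one heavy and deep tree (`measure_two_trees_le`).
* *Exponential moments* of the size of `T` (`lintegral_pow_sz_le`).

Let `S` be the size of `J_0` and `R` a large constant. A tree of depth at most `S / R` in `J_0` weighs
at most `S Q ^ (S / R)`, a small exponential of `S`. So either the tree of the spine child carries the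
weight up to such a factor, or a tree in `J_0` of depth at least `S / R` carries it
(`lt_wt_sub_or_exists`). In the first case `J_0` is independent of what is conditioned on,
and its exponential moments absorb the loss from planting (`measure_sideSize_le`); in the second case
grafting gains `(mean) ^ (S / R)`. This gives `C ρ ^ k` with `ρ < 1`, and planting removes the
constant `C`.

The pairs of offspring number and bias are treated as one family of independent marks on the labels,
so that the marks seen from the children of the root are independent copies of the whole family
(`measurePreserving_split`). Outgrowths are replaced throughout by the sets
`WeightedTree.side`, described by prefixes of labels instead of connected components.
-/

noncomputable section

open scoped Classical

/-! ### Independent marks on the labels -/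

section IIDLabels

variable {X : Type*}

/-- The family of marks seen from the `j`-th child of the root. -/
def sub (j : ℕ) (e : Label → X) : Label → X := fun v => e (j :: v)

/-- The family of marks on the labels rebuilt from the mark of the root and the families seen from
the children of the root. -/
def glue (p : X × (ℕ → Label → X)) : Label → X
  | [] => p.1
  | j :: v => p.2 j v

/-- The family of marks `p.1` in which the mark of the root is replaced by `p.2`. -/
def setRoot (p : (Label → X) × X) : Label → X
  | [] => p.2
  | j :: v => p.1 (j :: v)

variable [MeasurableSpace X]

theorem measurable_sub (j : ℕ) : Measurable (sub (X := X) j) :=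
  measurable_pi_lambda _ fun v => measurable_pi_apply (j :: v)

theorem measurable_glue : Measurable (glue (X := X)) := by
  refine measurable_pi_lambda _ fun v => ?_
  cases v with
  | nil => exact measurable_fst
  | cons j v => exact (measurable_pi_apply v).comp ((measurable_pi_apply j).comp measurable_snd)

variable (ρ : Measure X) [IsProbabilityMeasure ρ]

/-- The law of a family of independent marks with law `ρ` on the labels. -/
abbrev labelLaw : Measure (Label → X) := Measure.infinitePi fun _ : Label => ρ

theorem measurePreserving_glue :
    MeasurePreserving (glue (X := X))
      (ρ.prod (Measure.infinitePi fun _ : ℕ => labelLaw ρ)) (labelLaw ρ) := by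
  refine ⟨measurable_glue, Measure.eq_infinitePi _ fun s t ht => ?_⟩
  have hms : MeasurableSet (Set.pi (s : Set Label) t) :=
    MeasurableSet.pi s.countable_toSet fun _ _ => ht _
  rw [Measure.map_apply measurable_glue hms]
  let A : Set X := if [] ∈ s then t [] else Set.univ
  let c : ℕ × Label → Label := fun p => p.1 :: p.2
  have hc : Function.Injective c := by
    rintro ⟨a, b⟩ ⟨a', b'⟩ h
    simpa [c] using h
  let s' : Finset (ℕ × Label) := s.preimage c hc.injOn
  let B : Set (ℕ → Label → X) :=
    (MeasurableEquiv.curry ℕ Label X).symm ⁻¹' (Set.pi (s' : Set (ℕ × Label)) fun p => t (c p))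
  have hms' : MeasurableSet (Set.pi (s' : Set (ℕ × Label)) fun p => t (c p)) :=
    MeasurableSet.pi s'.countable_toSet fun _ _ => ht _
  have hpre : glue ⁻¹' (Set.pi (s : Set Label) t) = A ×ˢ B := by
    ext ⟨x, f⟩
    simp only [Set.mem_preimage, Set.mem_pi, Set.mem_prod, A, B]
    constructor
    · intro h
      refine ⟨?_, ?_⟩
      · split_ifs with h0
        · exact h [] h0
        · trivial
      · rintro ⟨j, v⟩ hv
        exact h (j :: v) (by simpa [s'] using hv)
    · rintro ⟨h1, h2⟩ v hv
      cases v with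
      | nil =>
        have hv' : [] ∈ s := hv
        rw [if_pos hv'] at h1
        exact h1
      | cons j v => exact h2 (j, v) (by simpa [s'] using hv)
  rw [hpre, Measure.prod_prod]
  have hB : (Measure.infinitePi fun _ : ℕ => labelLaw ρ) B = ∏ p ∈ s', ρ (t (c p)) := by
    rw [← Measure.map_apply (MeasurableEquiv.measurable _) hms',
      Measure.infinitePi_map_curry_symm (fun (_ : ℕ) (_ : Label) => ρ),
      Measure.infinitePi_pi _ fun _ _ => ht _]
  have hs : s = (if [] ∈ s then {[]} else ∅) ∪ s'.image c := by
    ext v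
    cases v with
    | nil => by_cases h0 : [] ∈ s <;> simp [h0, c]
    | cons j v => by_cases h0 : [] ∈ s <;> simp [h0, c, s']
  rw [hB]
  conv_rhs => rw [hs]
  rw [Finset.prod_union, Finset.prod_image fun a _ b _ h => hc h]
  · congr 1
    by_cases h0 : [] ∈ s <;> simp [h0, A]
  · by_cases h0 : [] ∈ s <;> simp [h0, c]

/-- The root's mark and the families seen from the children of the root are independent; each of
the latter is distributed as the whole family. -/
theorem measurePreserving_split :
    MeasurePreserving (fun e : Label → X => (e [], fun j : ℕ => sub j e)) (labelLaw ρ)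
      (ρ.prod (Measure.infinitePi fun _ : ℕ => labelLaw ρ)) := by
  have hm : Measurable (fun e : Label → X => (e [], fun j : ℕ => sub j e)) :=
    (measurable_pi_apply _).prodMk (measurable_pi_lambda _ fun j => measurable_sub j)
  refine ⟨hm, ?_⟩
  conv_lhs => rw [← (measurePreserving_glue ρ).map_eq, Measure.map_map hm measurable_glue]
  exact Measure.map_id

theorem measurePreserving_split_fin (n : ℕ) :
    MeasurePreserving (fun e : Label → X => (e [], fun j : Fin n => sub (j : ℕ) e)) (labelLaw ρ)
      (ρ.prod (Measure.pi fun _ : Fin n => labelLaw ρ)) := by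
  have h1 : MeasurePreserving (fun (f : ℕ → Label → X) (j : Fin n) => f j)
      (Measure.infinitePi fun _ : ℕ => labelLaw ρ) (Measure.pi fun _ : Fin n => labelLaw ρ) := by
    refine ⟨by fun_prop, ?_⟩
    rw [Measure.map_infinitePi_infinitePi_of_inj Fin.val_injective, Measure.infinitePi_eq_pi]
  exact ((MeasurePreserving.id ρ).prod h1).comp (measurePreserving_split ρ)

end IIDLabels

section Zip

/-- The whole space exhausts itself, as a square cylinder. -/
def spanningSquareCylinders {ι Z : Type*} [MeasurableSpace Z] (τ : Measure Z)
    [IsProbabilityMeasure τ] :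
    (Measure.infinitePi fun _ : ι => τ).FiniteSpanningSetsIn
      (squareCylinders fun _ : ι => {s : Set Z | MeasurableSet s}) where
  set := fun _ => Set.univ
  set_mem := fun _ => ⟨∅, fun _ => Set.univ, fun _ _ => MeasurableSet.univ, by simp⟩
  finite := fun _ => by simp
  spanning := Set.iUnion_const _

variable {ι X Y : Type*} [MeasurableSpace X] [MeasurableSpace Y]

/-- A family of independent pairs with law `ρ.prod σ` amounts to two independent families of
independent elements with laws `ρ` and `σ`. -/
theorem measurePreserving_unzip (ρ : Measure X) [IsProbabilityMeasure ρ] (σ : Measure Y)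
    [IsProbabilityMeasure σ] :
    MeasurePreserving (fun e : ι → X × Y => ((fun i => (e i).1, fun i => (e i).2) :
        (ι → X) × (ι → Y)))
      (Measure.infinitePi fun _ : ι => ρ.prod σ)
      ((Measure.infinitePi fun _ : ι => ρ).prod (Measure.infinitePi fun _ : ι => σ)) := by
  have hm : Measurable (fun e : ι → X × Y => ((fun i => (e i).1, fun i => (e i).2) :
        (ι → X) × (ι → Y))) := by fun_prop
  refine ⟨hm, Eq.symm ?_⟩
  refine Measure.prod_eq_generateFrom generateFrom_squareCylinders generateFrom_squareCylinders
    (isPiSystem_squareCylinders (fun _ => MeasurableSpace.isPiSystem_measurableSet) (by simp))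
    (isPiSystem_squareCylinders (fun _ => MeasurableSpace.isPiSystem_measurableSet) (by simp))
    (spanningSquareCylinders ρ) (spanningSquareCylinders σ) ?_
  rintro _ ⟨s, A, hA, rfl⟩ _ ⟨t, B, hB, rfl⟩
  have hA' : ∀ i, MeasurableSet (A i) := fun i => hA i trivial
  have hB' : ∀ i, MeasurableSet (B i) := fun i => hB i trivial
  rw [Measure.map_apply hm ((MeasurableSet.pi s.countable_toSet fun _ _ => hA' _).prod
    (MeasurableSet.pi t.countable_toSet fun _ _ => hB' _))]
  let A' : ι → Set X := fun i => if i ∈ s then A i else Set.univ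
  let B' : ι → Set Y := fun i => if i ∈ t then B i else Set.univ
  have hpre : (fun e : ι → X × Y => ((fun i => (e i).1, fun i => (e i).2) :
        (ι → X) × (ι → Y))) ⁻¹' ((s : Set ι).pi A ×ˢ (t : Set ι).pi B)
      = ((s ∪ t : Finset ι) : Set ι).pi fun i => A' i ×ˢ B' i := by
    ext e
    simp only [Set.mem_preimage, Set.mem_prod, Set.mem_pi, Finset.coe_union, Set.mem_union,
      Finset.mem_coe, A', B']
    constructor
    · rintro ⟨h1, h2⟩ i _
      constructor
      · split_ifs with h
        · exact h1 i h
        · trivial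
      · split_ifs with h
        · exact h2 i h
        · trivial
    · intro h
      refine ⟨fun i hi => ?_, fun i hi => ?_⟩
      · have := (h i (Or.inl hi)).1
        rwa [if_pos hi] at this
      · have := (h i (Or.inr hi)).2
        rwa [if_pos hi] at this
  have hmA : ∀ i, MeasurableSet (A' i) := fun i => by
    by_cases h : i ∈ s <;> simp [A', h, hA']
  have hmB : ∀ i, MeasurableSet (B' i) := fun i => by
    by_cases h : i ∈ t <;> simp [B', h, hB']
  rw [hpre, Measure.infinitePi_pi _ fun i _ => (hmA i).prod (hmB i),
    Measure.infinitePi_pi _ fun i _ => hA' i, Measure.infinitePi_pi _ fun i _ => hB' i]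
  simp only [Measure.prod_prod, Finset.prod_mul_distrib]
  congr 1
  · rw [← Finset.prod_subset Finset.subset_union_left]
    · exact Finset.prod_congr rfl fun i hi => by simp [A', hi]
    · intro i _ hi
      simp [A', hi]
  · rw [← Finset.prod_subset Finset.subset_union_right]
    · exact Finset.prod_congr rfl fun i hi => by simp [B', hi]
    · intro i _ hi
      simp [B', hi]

end Zip

section Resample

variable {X Y : Type*} [MeasurableSpace X] [MeasurableSpace Y]

/-- The family of marks `p.1` in which the second component of the root's mark is replaced by
`p.2`. -/
def setBias (p : (Label → X × Y) × Y) : Label → X × Y := setRoot (p.1, ((p.1 []).1, p.2))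

/-- Resampling the second component of the root's mark does not change the law of the marks. -/
theorem measurePreserving_setBias (ρ : Measure X) [IsProbabilityMeasure ρ] (σ : Measure Y)
    [IsProbabilityMeasure σ] :
    MeasurePreserving (setBias (X := X) (Y := Y)) ((labelLaw (ρ.prod σ)).prod σ)
      (labelLaw (ρ.prod σ)) := by
  have h1 := (measurePreserving_split (ρ.prod σ)).prod (MeasurePreserving.id σ)
  have h2 : MeasurePreserving
      (fun p : ((X × Y) × (ℕ → Label → X × Y)) × Y => (((p.1.1.1, p.2) : X × Y), p.1.2))
      (((ρ.prod σ).prod (Measure.infinitePi fun _ : ℕ => labelLaw (ρ.prod σ))).prod σ)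
      ((ρ.prod σ).prod (Measure.infinitePi fun _ : ℕ => labelLaw (ρ.prod σ))) := by
    have hσ := MeasurePreserving.id σ
    let Q := Measure.infinitePi fun _ : ℕ => labelLaw (ρ.prod σ)
    have hQ := MeasurePreserving.id Q
    have a1 : MeasurePreserving _ (((ρ.prod σ).prod Q).prod σ) ((ρ.prod Q).prod σ) :=
      ((measurePreserving_fst (μ := ρ) (ν := σ)).prod hQ).prod hσ
    have a2 := measurePreserving_prodAssoc ρ Q σ
    have a3 : MeasurePreserving _ (ρ.prod (Q.prod σ)) (ρ.prod (σ.prod Q)) :=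
      (MeasurePreserving.id ρ).prod (Measure.measurePreserving_swap (μ := Q) (ν := σ))
    have a4 := (measurePreserving_prodAssoc ρ σ Q).symm
    exact a4.comp (a3.comp (a2.comp a1))
  have h3 := (measurePreserving_glue (ρ.prod σ)).comp (h2.comp h1)
  convert h3 using 1
  ext ⟨e, y⟩ v : 2
  cases v <;> rfl

end Resample

/-! ### Recursive structure of finite weighted trees -/

namespace WeightedTree

variable (T : WeightedTree)

theorem vBase_mem_filter : T.vBase ∈ T.verts.filter fun v => v.length = T.depth :=
  Finset.min'_mem _ _

theorem vBase_mem : T.vBase ∈ T.verts := (Finset.mem_filter.1 T.vBase_mem_filter).1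

theorem length_vBase : T.vBase.length = T.depth := (Finset.mem_filter.1 T.vBase_mem_filter).2

theorem length_le_depth {v : Label} (hv : v ∈ T.verts) : v.length ≤ T.depth :=
  Finset.le_sup (f := List.length) hv

theorem vBase_le {v : Label} (hv : v ∈ T.verts) (h : v.length = T.depth) : T.vBase ≤ v :=
  Finset.min'_le _ _ (Finset.mem_filter.2 ⟨hv, h⟩)

theorem length_psi {i : ℕ} (hi : i ≤ T.depth) : (T.psi i).length = i := by
  simp [psi, length_vBase, hi]

theorem dropLast_psi_succ {i : ℕ} (hi : i < T.depth) : (T.psi (i + 1)).dropLast = T.psi i := by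
  rw [List.dropLast_eq_take, T.length_psi hi, psi, psi, List.take_take]
  simp

/-- The vertices that descend from `ψ_i` but not from `ψ_{i+1}`. They are the vertices of the `i`-th
outgrowth, described without reference to connected components. -/
def side (i : ℕ) : Finset Label :=
  if i ≤ T.depth then
    T.verts.filter fun v => T.psi i <+: v ∧ ¬(i < T.depth ∧ T.psi (i + 1) <+: v)
  else ∅

theorem prefix_dropLast {u w : Label} (h : u <+: w) (hne : u ≠ w) : u <+: w.dropLast := by
  obtain ⟨t, rfl⟩ := h
  have ht : t ≠ [] := by rintro rfl; simp at hne
  rw [List.dropLast_append_of_ne_nil ht]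
  exact List.prefix_append _ _

/-- The defining condition of `side` is preserved along edges outside the path to the base vertex. -/
theorem side_closed {i : ℕ} (hi : i ≤ T.depth) {u w : Label}
    (hadj : (T.graph.deleteEdges T.spineEdges).Adj u w)
    (hu : T.psi i <+: u ∧ ¬(i < T.depth ∧ T.psi (i + 1) <+: u)) :
    T.psi i <+: w ∧ ¬(i < T.depth ∧ T.psi (i + 1) <+: w) := by
  rw [SimpleGraph.deleteEdges_adj] at hadj
  obtain ⟨⟨-, -, hadj⟩, hspine⟩ := hadj
  rcases hadj with ⟨hw, rfl⟩ | ⟨hne, rfl⟩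
  · refine ⟨hu.1.trans (List.dropLast_prefix w), ?_⟩
    rintro ⟨hlt, hpre⟩
    by_cases heq : T.psi (i + 1) = w
    · refine hspine ⟨i, hlt, ?_⟩
      rw [← heq, T.dropLast_psi_succ hlt]
    · exact hu.2 ⟨hlt, prefix_dropLast hpre heq⟩
  · refine ⟨?_, fun h => hu.2 ⟨h.1, h.2.trans (List.dropLast_prefix u)⟩⟩
    by_cases heq : T.psi i = u
    · exfalso
      obtain ⟨k, rfl⟩ : ∃ k, i = k + 1 := by
        refine Nat.exists_eq_succ_of_ne_zero ?_
        rintro rfl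
        exact hne (by rw [← heq]; simp [psi])
      refine hspine ⟨k, by omega, ?_⟩
      rw [← heq, T.dropLast_psi_succ (by omega), Sym2.eq_swap]
    · exact prefix_dropLast hu.1 heq

theorem outgrowth_subset_side (i : ℕ) : T.outgrowth i ⊆ T.side i := by
  unfold outgrowth side
  split_ifs with hi
  · intro v hv
    simp only [Finset.mem_filter] at hv ⊢
    refine ⟨hv.1, ?_⟩
    obtain ⟨p⟩ := hv.2
    have key : ∀ {a b : Label} (p : (T.graph.deleteEdges T.spineEdges).Walk a b),
        (T.psi i <+: a ∧ ¬(i < T.depth ∧ T.psi (i + 1) <+: a)) →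
        (T.psi i <+: b ∧ ¬(i < T.depth ∧ T.psi (i + 1) <+: b)) := by
      intro a b p
      induction p with
      | nil => exact id
      | cons h _ ih => exact fun ha => ih (T.side_closed hi h ha)
    refine key p ⟨List.prefix_rfl, ?_⟩
    rintro ⟨hlt, hpre⟩
    have := hpre.length_le
    rw [T.length_psi hlt, T.length_psi hi] at this
    omega
  · simp

theorem side_congr {T T' : WeightedTree} (h : T.verts = T'.verts) (i : ℕ) :
    T.side i = T'.side i := by
  cases T; cases T'
  obtain rfl : _ = _ := h
  rfl

end WeightedTree

/-- The marks of the individuals: the number of children, and the bias of the edge to the parent. -/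
abbrev Marks := Label → ℕ × ℝ

/-- The number of children of the root. -/
def kids (e : Marks) : ℕ := (e []).1

/-- The bias of the edge which would join the root to a parent. -/
def rootBias (e : Marks) : ℝ := (e []).2

/-- The weighted Galton-Watson tree with given marks. -/
def markTree (e : Marks) : WeightedTree := gwTree (fun v => (e v).1, fun v => (e v).2)

/-- The vertex set of the Galton-Watson tree, possibly infinite. -/
def markVerts (e : Marks) : Set Label := gwVerts fun v => (e v).1

/-- `ω(T)` as a function of the marks. -/
def wt (e : Marks) : ℝ := (markTree e).weight

/-- `D(T)` as a function of the marks. -/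
def dep (e : Marks) : ℕ := (markTree e).depth

/-- The number of vertices as a function of the marks. -/
def sz (e : Marks) : ℕ := (markTree e).verts.card

/-- The size of the `i`-th outgrowth as a function of the marks. -/
def og (i : ℕ) (e : Marks) : ℕ := ((markTree e).side i).card

/-- The marks are regular if the tree is finite and all biases lie in `[q, Q]`. -/
def Regular (q Q : ℝ) (e : Marks) : Prop :=
  (markVerts e).Finite ∧ ∀ v, q ≤ (e v).2 ∧ (e v).2 ≤ Q

theorem cons_mem_markVerts {e : Marks} {j : ℕ} {v : Label} :
    j :: v ∈ markVerts e ↔ j < kids e ∧ v ∈ markVerts (sub j e) := by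
  unfold markVerts gwVerts kids sub
  simp only [Set.mem_ofPred_eq]
  constructor
  · intro h
    refine ⟨h 0 (by simp), fun i hi => ?_⟩
    exact h (i + 1) (Nat.succ_lt_succ hi)
  · rintro ⟨h0, h⟩ i hi
    cases i with
    | zero => simpa using h0
    | succ i => simpa using h i (by simpa using hi)

theorem finite_markVerts_sub {e : Marks} (he : (markVerts e).Finite) {j : ℕ} (hj : j < kids e) :
    (markVerts (sub j e)).Finite := by
  refine (he.preimage (f := List.cons j) (List.cons_injective.injOn)).subset fun v hv => ?_
  exact cons_mem_markVerts.2 ⟨hj, hv⟩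

theorem Regular.sub {q Q : ℝ} {e : Marks} (he : Regular q Q e) {j : ℕ} (hj : j < kids e) :
    Regular q Q (sub j e) :=
  ⟨finite_markVerts_sub he.1 hj, fun v => he.2 (j :: v)⟩

theorem bias_markTree (e : Marks) (v : Label) : (markTree e).bias v = (e v).2 := by
  unfold markTree gwTree
  split_ifs <;> rfl

section Finite

variable {e : Marks} (he : (markVerts e).Finite)
include he

theorem mem_verts {v : Label} : v ∈ (markTree e).verts ↔ v ∈ markVerts e := by
  unfold markTree gwTree
  rw [dif_pos (show (gwVerts fun v => (e v).1).Finite from he)]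
  simp [markVerts]

theorem cons_mem_verts {j : ℕ} {v : Label} (hj : j < kids e) :
    j :: v ∈ (markTree e).verts ↔ v ∈ (markTree (sub j e)).verts := by
  rw [mem_verts he, mem_verts (finite_markVerts_sub he hj), cons_mem_markVerts]
  exact and_iff_right hj

theorem verts_eq : (markTree e).verts =
    {[]} ∪ (Finset.range (kids e)).biUnion fun j =>
      (markTree (sub j e)).verts.image (List.cons j) := by
  ext v
  cases v with
  | nil => simp [(markTree e).root_mem]
  | cons j v =>
    simp only [Finset.mem_union, Finset.mem_singleton, reduceCtorEq, Finset.mem_biUnion,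
      Finset.mem_range, Finset.mem_image, List.cons.injEq, false_or]
    constructor
    · intro h
      have hj := (cons_mem_markVerts.1 ((mem_verts he).1 h)).1
      exact ⟨j, hj, v, (cons_mem_verts he hj).1 h, rfl, rfl⟩
    · rintro ⟨_, hj, _, hv, rfl, rfl⟩
      exact (cons_mem_verts he hj).2 hv

theorem sum_verts {M : Type*} [AddCommMonoid M] (f : Label → M) :
    ∑ v ∈ (markTree e).verts, f v =
      f [] + ∑ j ∈ Finset.range (kids e), ∑ v ∈ (markTree (sub j e)).verts, f (j :: v) := by
  rw [verts_eq he, Finset.sum_union, Finset.sum_singleton, Finset.sum_biUnion]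
  · congr 1
    refine Finset.sum_congr rfl fun j _ => ?_
    rw [Finset.sum_image fun a _ b _ h => List.cons_injective h]
  · intro j _ l _ hjl
    simp only [Function.onFun, Finset.disjoint_left, Finset.mem_image]
    rintro _ ⟨v, _, rfl⟩ ⟨w, _, h⟩
    exact hjl (List.cons.inj h).1.symm
  · simp

theorem sz_eq : sz e = 1 + ∑ j ∈ Finset.range (kids e), sz (sub j e) := by
  have := sum_verts he fun _ => 1
  simpa [sz] using this

theorem wt_eq :
    wt e = 1 + ∑ j ∈ Finset.range (kids e), rootBias (sub j e) * wt (sub j e) := by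
  unfold wt WeightedTree.weight
  rw [sum_verts he]
  congr 1
  refine Finset.sum_congr rfl fun j _ => ?_
  rw [Finset.mul_sum]
  refine Finset.sum_congr rfl fun v _ => ?_
  unfold WeightedTree.vertexWeight
  simp only [bias_markTree]
  rw [List.length_cons, Finset.prod_range_succ', mul_comm]
  simp [rootBias, sub]

theorem dep_eq_zero (h0 : kids e = 0) : dep e = 0 := by
  unfold dep WeightedTree.depth
  rw [verts_eq he, h0]
  simp

theorem dep_sub_lt {j : ℕ} (hj : j < kids e) : dep (sub j e) + 1 ≤ dep e := by
  have h := (markTree e).length_le_depth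
    ((cons_mem_verts he hj).2 (markTree (sub j e)).vBase_mem)
  rw [List.length_cons, (markTree (sub j e)).length_vBase] at h
  exact h

end Finite

/-- Among finitely many trees, the `j`-th is the first of those with maximal depth. If these are the
trees hanging from the children of the root, the path to the base vertex passes through the
`j`-th child. -/
def IsSpine {n : ℕ} (f : Fin n → Marks) (j : Fin n) : Prop :=
  (∀ l < j, dep (f l) < dep (f j)) ∧ ∀ l, dep (f l) ≤ dep (f j)

theorem IsSpine.unique {n : ℕ} {f : Fin n → Marks} {j l : Fin n} (hj : IsSpine f j)
    (hl : IsSpine f l) : j = l := by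
  rcases lt_trichotomy j l with h | h | h
  · exact absurd (hl.1 j h) (hj.2 l).not_gt
  · exact h
  · exact absurd (hj.1 l h) (hl.2 j).not_gt

theorem exists_isSpine {n : ℕ} (hn : 0 < n) (f : Fin n → Marks) : ∃ j, IsSpine f j := by
  have : Nonempty (Fin n) := ⟨⟨0, hn⟩⟩
  obtain ⟨i, hi⟩ := Finite.exists_max fun l => dep (f l)
  let S : Finset (Fin n) := Finset.univ.filter fun j => ∀ l, dep (f l) ≤ dep (f j)
  have hS : S.Nonempty := ⟨i, by simpa [S] using hi⟩
  have hmem := S.min'_mem hS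
  refine ⟨S.min' hS, fun l hl => ?_, by simpa [S] using hmem⟩
  by_contra hcon
  have hmax : ∀ k, dep (f k) ≤ dep (f (S.min' hS)) := by simpa [S] using hmem
  exact absurd (S.min'_le l (by simpa [S] using fun k => (hmax k).trans (not_lt.1 hcon)))
    hl.not_ge

section Spine

variable {e : Marks} (he : (markVerts e).Finite) {n : ℕ} (hn : kids e = n) {j : Fin n}
  (hj : IsSpine (fun l : Fin n => sub (l : ℕ) e) j)
include he hn hj

theorem dep_eq_of_isSpine : dep e = dep (sub (j : ℕ) e) + 1 := by
  refine le_antisymm ?_ (dep_sub_lt he (hn ▸ j.2))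
  refine Finset.sup_le fun v hv => ?_
  cases v with
  | nil => simp
  | cons l v =>
    have hl : l < kids e := (cons_mem_markVerts.1 ((mem_verts he).1 hv)).1
    have h1 := (markTree (sub l e)).length_le_depth ((cons_mem_verts he hl).1 hv)
    have h2 : dep (sub l e) ≤ dep (sub (j : ℕ) e) := hj.2 ⟨l, hn ▸ hl⟩
    simpa using h1.trans h2

theorem vBase_eq_of_isSpine :
    (markTree e).vBase = (j : ℕ) :: (markTree (sub (j : ℕ) e)).vBase := by
  have hjk : (j : ℕ) < kids e := hn ▸ j.2
  have hd : (markTree e).depth = (markTree (sub (j : ℕ) e)).depth + 1 :=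
    dep_eq_of_isSpine he hn hj
  refine le_antisymm ?_ ?_
  · refine WeightedTree.vBase_le _ ((cons_mem_verts he hjk).2 (WeightedTree.vBase_mem _)) ?_
    rw [hd, List.length_cons, WeightedTree.length_vBase]
  · have hmem := (markTree e).vBase_mem
    have hlen := (markTree e).length_vBase
    revert hmem hlen
    generalize (markTree e).vBase = w
    intro hmem hlen
    cases w with
    | nil => simp [hd] at hlen
    | cons l v =>
      have hl : l < kids e := (cons_mem_markVerts.1 ((mem_verts he).1 hmem)).1
      have hv := (cons_mem_verts he hl).1 hmem
      have hlen' : v.length = (markTree (sub (j : ℕ) e)).depth := by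
        rw [hd] at hlen; simpa using hlen
      have h1 := (markTree (sub l e)).length_le_depth hv
      rcases lt_trichotomy l j with h | h | h
      · have := hj.1 ⟨l, hn ▸ hl⟩ h
        unfold dep at this
        simp only at this
        omega
      · subst h
        rcases (WeightedTree.vBase_le _ hv hlen').lt_or_eq with h | h
        · exact le_of_lt (List.Lex.cons h)
        · rw [h]
      · exact le_of_lt (List.Lex.rel h)

theorem psi_succ_of_isSpine (i : ℕ) :
    (markTree e).psi (i + 1) = (j : ℕ) :: (markTree (sub (j : ℕ) e)).psi i := by
  unfold WeightedTree.psi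
  rw [vBase_eq_of_isSpine he hn hj, List.take_succ_cons]

theorem og_succ_of_isSpine (i : ℕ) : og (i + 1) e ≤ og i (sub (j : ℕ) e) := by
  have hjk : (j : ℕ) < kids e := hn ▸ j.2
  have hd : (markTree e).depth = (markTree (sub (j : ℕ) e)).depth + 1 :=
    dep_eq_of_isSpine he hn hj
  have hsub : (markTree e).side (i + 1) ⊆
      ((markTree (sub (j : ℕ) e)).side i).image (List.cons (j : ℕ)) := by
    unfold WeightedTree.side
    rw [hd]
    simp only [psi_succ_of_isSpine he hn hj, Nat.add_le_add_iff_right, Nat.add_lt_add_iff_right]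
    split_ifs with hi
    · intro v hv
      obtain ⟨hv, hpre, hnot⟩ := Finset.mem_filter.1 hv
      cases v with
      | nil => simp at hpre
      | cons l v =>
        obtain ⟨rfl, hpre'⟩ := List.cons_prefix_cons.1 hpre
        refine Finset.mem_image.2 ⟨v, Finset.mem_filter.2 ⟨(cons_mem_verts he hjk).1 hv, hpre', ?_⟩,
          rfl⟩
        exact fun h => hnot ⟨h.1, List.cons_prefix_cons.2 ⟨rfl, h.2⟩⟩
    · simp
  exact (Finset.card_le_card hsub).trans Finset.card_image_le

theorem og_zero_of_isSpine :
    og 0 e ≤ 1 + ∑ l ∈ Finset.univ.erase j, sz (sub (l : ℕ) e) := by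
  have hd : (markTree e).depth = (markTree (sub (j : ℕ) e)).depth + 1 :=
    dep_eq_of_isSpine he hn hj
  unfold og WeightedTree.side
  rw [if_pos (Nat.zero_le _), Finset.card_filter, sum_verts he, hn, Finset.sum_range]
  refine add_le_add (by split_ifs <;> simp) ?_
  rw [← Finset.add_sum_erase _ _ (Finset.mem_univ j)]
  have h0 : (∑ v ∈ (markTree (sub (j : ℕ) e)).verts,
      if (markTree e).psi 0 <+: (j : ℕ) :: v ∧
        ¬(0 < (markTree e).depth ∧ (markTree e).psi (0 + 1) <+: (j : ℕ) :: v) then 1 else 0) = 0 := by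
    refine Finset.sum_eq_zero fun v _ => if_neg fun h => h.2 ⟨by omega, ?_⟩
    rw [psi_succ_of_isSpine he hn hj]
    simp [WeightedTree.psi]
  rw [h0, zero_add]
  refine Finset.sum_le_sum fun l _ => ?_
  rw [sz, Finset.card_eq_sum_ones]
  exact Finset.sum_le_sum fun v _ => by split_ifs <;> simp

end Spine

theorem og_eq_zero_of_lt {e : Marks} {i : ℕ} (h : dep e < i) : og i e = 0 := by
  unfold og WeightedTree.side
  rw [if_neg (by unfold dep at h; omega)]
  simp

theorem og_le_sz (i : ℕ) (e : Marks) : og i e ≤ sz e := by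
  unfold og WeightedTree.side sz
  split_ifs
  · exact Finset.card_filter_le _ _
  · simp

theorem one_le_sz (e : Marks) : 1 ≤ sz e := Finset.card_pos.2 ⟨[], (markTree e).root_mem⟩

section Bounds

variable {q Q : ℝ} {e : Marks} (he : Regular q Q e)
include he

theorem one_le_wt (hq : 1 ≤ q) : 1 ≤ wt e := by
  unfold wt WeightedTree.weight
  have h1 : (markTree e).vertexWeight [] = 1 := by simp [WeightedTree.vertexWeight]
  rw [← h1]
  refine Finset.single_le_sum (f := (markTree e).vertexWeight) (fun v _ => ?_)
    (markTree e).root_mem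
  refine Finset.prod_nonneg fun i _ => ?_
  rw [bias_markTree]
  linarith [(he.2 (v.take (i + 1))).1]

theorem wt_le (hq : 1 ≤ q) : wt e ≤ sz e * Q ^ dep e := by
  have hQ : 1 ≤ Q := hq.trans ((he.2 []).1.trans (he.2 []).2)
  unfold wt WeightedTree.weight
  rw [← nsmul_eq_mul]
  refine Finset.sum_le_card_nsmul _ _ _ fun v hv => ?_
  calc (markTree e).vertexWeight v ≤ ∏ _j ∈ Finset.range v.length, Q := by
        refine Finset.prod_le_prod (fun i _ => ?_) fun i _ => ?_
        · rw [bias_markTree]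
          linarith [(he.2 (v.take (i + 1))).1]
        · rw [bias_markTree]
          exact (he.2 _).2
    _ = Q ^ v.length := by simp
    _ ≤ Q ^ dep e := pow_le_pow_right₀ hQ ((markTree e).length_le_depth hv)

end Bounds

/-! ### Measurability, and the decomposition of the law at the root -/

section Measurability

theorem measurable_kids : Measurable kids := measurable_fst.comp (measurable_pi_apply _)

theorem measurable_rootBias : Measurable rootBias := measurable_snd.comp (measurable_pi_apply _)

theorem measurableSet_mem_markVerts (v : Label) : MeasurableSet {e : Marks | v ∈ markVerts e} := by
  have : {e : Marks | v ∈ markVerts e} =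
      ⋂ (j : ℕ) (hj : j < v.length), {e : Marks | v[j] < (e (v.take j)).1} := by
    ext e
    simp [markVerts, gwVerts]
  rw [this]
  refine MeasurableSet.iInter fun j => MeasurableSet.iInter fun hj => ?_
  exact measurableSet_lt measurable_const (measurable_fst.comp (measurable_pi_apply _))

theorem measurableSet_markVerts_eq (S : Finset Label) :
    MeasurableSet {e : Marks | markVerts e = S} := by
  have : {e : Marks | markVerts e = S} = ⋂ v : Label, {e : Marks | v ∈ markVerts e ↔ v ∈ S} := by
    ext e
    simp [Set.ext_iff]
  rw [this]
  refine MeasurableSet.iInter fun v => ?_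
  by_cases hv : v ∈ S
  · simpa [hv] using measurableSet_mem_markVerts v
  · have h := (measurableSet_mem_markVerts v).compl
    simp only [hv, iff_false]
    exact h

theorem measurableSet_finite_markVerts : MeasurableSet {e : Marks | (markVerts e).Finite} := by
  have : {e : Marks | (markVerts e).Finite} = ⋃ S : Finset Label, {e : Marks | markVerts e = S} := by
    ext e
    simp only [Set.mem_ofPred_eq, Set.mem_iUnion]
    exact ⟨fun h => ⟨h.toFinset, by simp⟩, fun ⟨S, hS⟩ => hS ▸ S.finite_toSet⟩
  rw [this]
  exact MeasurableSet.iUnion measurableSet_markVerts_eq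

theorem verts_of_infinite {e : Marks} (he : ¬(markVerts e).Finite) :
    (markTree e).verts = {[]} := by
  unfold markTree gwTree
  rw [dif_neg (show ¬(gwVerts fun v => (e v).1).Finite from he)]

theorem measurableSet_verts_eq (S : Finset Label) :
    MeasurableSet {e : Marks | (markTree e).verts = S} := by
  have : {e : Marks | (markTree e).verts = S} =
      ({e : Marks | (markVerts e).Finite} ∩ {e : Marks | markVerts e = S}) ∪
        ({e : Marks | (markVerts e).Finite}ᶜ ∩ {_e : Marks | S = {[]}}) := by
    ext e
    by_cases he : (markVerts e).Finite
    · have : (markTree e).verts = S ↔ markVerts e = S := by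
        rw [Finset.ext_iff, Set.ext_iff]
        simp only [mem_verts he, Finset.mem_coe]
      simpa [he] using this
    · simpa [he, verts_of_infinite he] using eq_comm
  rw [this]
  exact (measurableSet_finite_markVerts.inter (measurableSet_markVerts_eq S)).union
    (measurableSet_finite_markVerts.compl.inter (MeasurableSet.const _))

theorem measurable_of_verts {α : Type*} [MeasurableSpace α] {f : Marks → α}
    (hf : ∀ e e', (markTree e).verts = (markTree e').verts → f e = f e') : Measurable f := by
  intro s _
  have : f ⁻¹' s = ⋃ S ∈ (fun e => (markTree e).verts) '' (f ⁻¹' s),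
      {e : Marks | (markTree e).verts = S} := by
    ext e
    simp only [Set.mem_preimage, Set.mem_iUnion, Set.mem_image, Set.mem_ofPred_eq, exists_prop]
    constructor
    · exact fun h => ⟨_, ⟨e, h, rfl⟩, rfl⟩
    · rintro ⟨_, ⟨e', h, rfl⟩, he⟩
      rwa [hf e e' he]
  rw [this]
  exact MeasurableSet.biUnion (Set.to_countable _) fun S _ => measurableSet_verts_eq S

theorem measurable_dep : Measurable dep := measurable_of_verts fun e e' h => by
  unfold dep WeightedTree.depth
  rw [h]

theorem measurable_sz : Measurable sz := measurable_of_verts fun e e' h => by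
  unfold sz
  rw [h]

theorem measurable_og (i : ℕ) : Measurable (og i) := measurable_of_verts fun e e' h => by
  unfold og
  rw [WeightedTree.side_congr h]

theorem measurable_wt : Measurable wt := by
  have hf : ∀ S : Finset Label, Measurable fun e : Marks =>
      ∑ v ∈ S, ∏ j ∈ Finset.range v.length, (e (v.take (j + 1))).2 := fun S => by fun_prop
  intro s hs
  have : wt ⁻¹' s = ⋃ S : Finset Label, {e : Marks | (markTree e).verts = S} ∩
      (fun e : Marks => ∑ v ∈ S, ∏ j ∈ Finset.range v.length, (e (v.take (j + 1))).2) ⁻¹' s := by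
    ext e
    simp [wt, WeightedTree.weight, WeightedTree.vertexWeight, bias_markTree]
  rw [this]
  exact MeasurableSet.iUnion fun S => (measurableSet_verts_eq S).inter (hf S hs)

end Measurability

section Law

/-- The law of the marks: the pairs of the number of children and of the bias are independent, and
distributed as `h ⊗ ν`. -/
abbrev markLaw (h : PMF ℕ) (ν : Measure ℝ) : Measure Marks := labelLaw (h.toMeasure.prod ν)

variable (h : PMF ℕ) (ν : Measure ℝ) [IsProbabilityMeasure ν]

theorem measure_kids_eq (n : ℕ) : markLaw h ν {e | kids e = n} = h n := by
  have h1 := ((measurePreserving_fst (μ := h.toMeasure) (ν := ν)).comp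
    (measurePreserving_eval_infinitePi (fun _ : Label => h.toMeasure.prod ν) [])).measure_preimage
    (measurableSet_singleton n).nullMeasurableSet
  rw [PMF.toMeasure_apply_singleton _ _ (measurableSet_singleton n)] at h1
  exact h1

/-- Decomposition at the root: given that the root has `n` children, the families of marks seen
from them are independent and distributed as the whole family. -/
theorem setLIntegral_kids_eq (n : ℕ) {F : (Fin n → Marks) → ℝ≥0∞} (hF : Measurable F) :
    ∫⁻ e in {e | kids e = n}, F (fun j => sub (j : ℕ) e) ∂markLaw h ν =
      h n * ∫⁻ f, F f ∂Measure.pi fun _ : Fin n => markLaw h ν := by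
  have hmk : MeasurableSet {e : Marks | kids e = n} := measurable_kids (measurableSet_singleton n)
  let G : (ℕ × ℝ) → ℝ≥0∞ := fun p => ({n} : Set ℕ).indicator 1 p.1
  have hG : Measurable G :=
    (measurable_one.indicator (measurableSet_singleton n)).comp measurable_fst
  have hm := measurePreserving_split_fin (h.toMeasure.prod ν) n
  have h1 := hm.lintegral_comp (f := fun p => G p.1 * F p.2) (by fun_prop)
  rw [lintegral_prod_mul hG.aemeasurable hF.aemeasurable] at h1
  have h2 : ∫⁻ p, G p ∂h.toMeasure.prod ν = h n := by
    have := (measurePreserving_fst (μ := h.toMeasure) (ν := ν)).lintegral_comp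
      (measurable_one.indicator (measurableSet_singleton n) :
        Measurable (({n} : Set ℕ).indicator (1 : ℕ → ℝ≥0∞)))
    rw [lintegral_indicator_one (measurableSet_singleton n),
      PMF.toMeasure_apply_singleton _ _ (measurableSet_singleton n)] at this
    exact this
  rw [h2] at h1
  rw [← h1, ← lintegral_indicator hmk]
  refine lintegral_congr fun e => ?_
  by_cases he : kids e = n
  · have he' : (e []).1 = n := he
    simp [Set.indicator, he, G, he']
  · have he' : ¬(e []).1 = n := he
    simp [Set.indicator, he, G, he']

theorem measure_kids_eq_inter (n : ℕ) {A : Set (Fin n → Marks)} (hA : MeasurableSet A) :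
    markLaw h ν {e | kids e = n ∧ (fun j : Fin n => sub (j : ℕ) e) ∈ A} =
      h n * Measure.pi (fun _ : Fin n => markLaw h ν) A := by
  have hmk : MeasurableSet {e : Marks | kids e = n} := measurable_kids (measurableSet_singleton n)
  have hms : Measurable fun (e : Marks) (j : Fin n) => sub (j : ℕ) e :=
    measurable_pi_lambda _ fun j => measurable_sub _
  have := setLIntegral_kids_eq h ν n (measurable_one.indicator hA : Measurable (A.indicator 1))
  rw [lintegral_indicator_one hA] at this
  rw [← this]
  have h2 : (fun e : Marks => A.indicator (1 : (Fin n → Marks) → ℝ≥0∞) fun j : Fin n => sub (j : ℕ) e) =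
      ((fun (e : Marks) (j : Fin n) => sub (j : ℕ) e) ⁻¹' A).indicator 1 := rfl
  rw [h2, lintegral_indicator_one (hms hA), Measure.restrict_apply (hms hA), Set.inter_comm]
  rfl

theorem lintegral_eq_tsum_kids (P : Measure Marks) (F : Marks → ℝ≥0∞) :
    ∫⁻ e, F e ∂P = ∑' n, ∫⁻ e in {e | kids e = n}, F e ∂P := by
  have hm : ∀ n, MeasurableSet {e : Marks | kids e = n} := fun n =>
    measurable_kids (measurableSet_singleton n)
  rw [← lintegral_iUnion hm]
  · rw [← setLIntegral_univ]
    congr 2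
    ext e
    simp
  · intro i j hij
    simp only [Function.onFun, Set.disjoint_left]
    exact fun e he he' => hij (he.symm.trans he')

theorem measure_eq_tsum_kids (P : Measure Marks) {A : Set Marks} (hA : MeasurableSet A) :
    P A = ∑' n, P {e | kids e = n ∧ e ∈ A} := by
  rw [← lintegral_indicator_one hA, lintegral_eq_tsum_kids]
  congr 1
  ext n
  rw [lintegral_indicator_one hA, Measure.restrict_apply hA, Set.inter_comm]
  rfl

theorem lintegral_pi_prod {n : ℕ} {G : Marks → ℝ≥0∞} (hG : Measurable G) :
    ∫⁻ f, ∏ j, G (f j) ∂(Measure.pi fun _ : Fin n => markLaw h ν) =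
      (∫⁻ e, G e ∂markLaw h ν) ^ n := by
  rw [lintegral_prod_eq_prod_lintegral_of_indepFun Finset.univ
    (fun (j : Fin n) (f : Fin n → Marks) => G (f j))]
  · rw [Finset.prod_congr rfl fun j _ => ((measurePreserving_eval
      (fun _ : Fin n => markLaw h ν) j).lintegral_comp hG)]
    simp
  · exact (iIndepFun_pi (X := fun _ => G) fun _ => hG.aemeasurable)
  · fun_prop

/-- The biases lie in any interval which carries their law. -/
theorem ae_bias {q Q : ℝ} (hν : ∀ᵐ x ∂ν, q ≤ x ∧ x ≤ Q) :
    ∀ᵐ e ∂markLaw h ν, ∀ v, q ≤ (e v).2 ∧ (e v).2 ≤ Q :=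
  ae_all_iff.2 fun v => ((measurePreserving_snd (μ := h.toMeasure) (ν := ν)).comp
    (measurePreserving_eval_infinitePi (fun _ : Label => h.toMeasure.prod ν)
      v)).quasiMeasurePreserving.ae hν

end Law

/-! ### Exponential moments of the offspring law and of the tree size -/

section Offspring

theorem one_add_pow_le (t : ℝ) (ht : 0 ≤ t) (n : ℕ) : (1 + t) ^ n ≤ 1 + n * (t * (1 + t) ^ n) := by
  induction n with
  | zero => simp
  | succ n ih =>
    have h1 : (1 + t) ^ n ≤ (1 + t) ^ (n + 1) := pow_le_pow_right₀ (by linarith) (Nat.le_succ n)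
    have h2 : (1 + t) ^ (n + 1) = (1 + t) ^ n + t * (1 + t) ^ n := by ring
    have h3 : (n : ℝ) * (t * (1 + t) ^ n) ≤ n * (t * (1 + t) ^ (n + 1)) := by gcongr
    have h4 : t * (1 + t) ^ n ≤ t * (1 + t) ^ (n + 1) := by gcongr
    push_cast
    linarith

variable {h : PMF ℕ}

theorem SubcriticalExpTail.exists_geometric (hh : SubcriticalExpTail h) :
    ∃ r : ℝ, 0 < r ∧ r < 1 ∧ ∀ n, h n ≤ ENNReal.ofReal (r ^ n) := by
  obtain ⟨c, hc, htail⟩ := hh.exp_tail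
  refine ⟨Real.exp (-c), Real.exp_pos _, Real.exp_lt_one_iff.2 (by linarith), fun n => ?_⟩
  rw [← Real.exp_nat_mul, mul_comm]
  exact (ENNReal.le_tsum (f := fun l : Set.Ici n => h l) ⟨n, Set.mem_Ici.2 le_rfl⟩).trans (htail n)

theorem tsum_pow_mul_lt_top {r y : ℝ} (hr : 0 < r) (hh : ∀ n, h n ≤ ENNReal.ofReal (r ^ n))
    (hy : 0 ≤ y) (hry : r * y < 1) (p : ℕ) :
    ∑' n : ℕ, (n : ℝ≥0∞) ^ p * h n * ENNReal.ofReal y ^ n < ⊤ := by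
  have hs : Summable fun n : ℕ => (n : ℝ) ^ p * (r * y) ^ n :=
    summable_pow_mul_geometric_of_norm_lt_one p (by
      rw [Real.norm_of_nonneg (by positivity)]
      exact hry)
  refine lt_of_le_of_lt (ENNReal.tsum_le_tsum fun n => ?_) (lt_top_iff_ne_top.2 hs.tsum_ofReal_ne_top)
  calc (n : ℝ≥0∞) ^ p * h n * ENNReal.ofReal y ^ n
      ≤ (n : ℝ≥0∞) ^ p * ENNReal.ofReal (r ^ n) * ENNReal.ofReal y ^ n := by gcongr; exact hh n
    _ = ENNReal.ofReal ((n : ℝ) ^ p * (r * y) ^ n) := by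
      rw [mul_pow, ENNReal.ofReal_mul (by positivity), ENNReal.ofReal_mul (by positivity),
        ENNReal.ofReal_pow (Nat.cast_nonneg n), ENNReal.ofReal_pow hy, ENNReal.ofReal_natCast,
        mul_assoc]

/-- For `x > 1` close to `1` the generating function of a subcritical offspring law lies below the
identity, with room for a factor `a > 1`; its derivative is moreover finite at `x`. -/
theorem SubcriticalExpTail.exists_tilt (hh : SubcriticalExpTail h) :
    ∃ a x : ℝ, 1 < a ∧ 1 < x ∧
      ENNReal.ofReal a * ∑' n, h n * ENNReal.ofReal x ^ n ≤ ENNReal.ofReal x ∧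
      ∑' n : ℕ, (n : ℝ≥0∞) * h n * ENNReal.ofReal x ^ n < ⊤ := by
  obtain ⟨r, hr0, hr1, hr⟩ := hh.exists_geometric
  obtain ⟨y, hy1, hyr⟩ := exists_between ((one_lt_inv₀ hr0).2 hr1)
  have hry : r * y < 1 := by
    calc r * y < r * r⁻¹ := by gcongr
      _ = 1 := mul_inv_cancel₀ hr0.ne'
  -- `y > 1` is still inside the disc of convergence, so `M` bounds the second derivative of the
  -- generating function up to `y`; `x = 1 + t` with `t` so small that the derivative at `x` is `< 1`
  have hM := tsum_pow_mul_lt_top hr0 hr (by linarith) hry 2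
  set M := ∑' n : ℕ, (n : ℝ≥0∞) ^ 2 * h n * ENNReal.ofReal y ^ n with hMdef
  have hl := hh.mean_lt_one
  set l := ∑' k : ℕ, (k : ℝ≥0∞) * h k with hldef
  have hl1 : l.toReal < 1 := by
    rw [← ENNReal.toReal_one]
    exact ENNReal.toReal_strict_mono ENNReal.one_ne_top hl
  have hM0 : 0 ≤ M.toReal := ENNReal.toReal_nonneg
  set t := min (y - 1) ((1 - l.toReal) / (2 * (M.toReal + 1))) with ht
  have ht0 : 0 < t := lt_min (by linarith) (div_pos (by linarith) (by linarith))
  have hty : 1 + t ≤ y := by linarith [min_le_left (y - 1) ((1 - l.toReal) / (2 * (M.toReal + 1)))]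
  set d := l.toReal + t * M.toReal with hd
  have hd0 : 0 ≤ d := by positivity
  have hd1 : d < 1 := by
    have h1 : t * (2 * (M.toReal + 1)) ≤ 1 - l.toReal := by
      rw [← le_div_iff₀ (by linarith)]
      exact min_le_right _ _
    have h2 : t * M.toReal ≤ t * (M.toReal + 1) := by gcongr; linarith
    linarith
  have hpow : ∀ n : ℕ, ENNReal.ofReal (1 + t) ^ n ≤
      1 + n * (ENNReal.ofReal t * ENNReal.ofReal (1 + t) ^ n) := fun n => by
    have := ENNReal.ofReal_le_ofReal (one_add_pow_le t ht0.le n)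
    rwa [ENNReal.ofReal_add (by positivity) (by positivity), ENNReal.ofReal_one,
      ENNReal.ofReal_mul (by positivity), ENNReal.ofReal_mul (by positivity),
      ENNReal.ofReal_pow (by positivity), ENNReal.ofReal_natCast] at this
  have hder : ∑' n : ℕ, (n : ℝ≥0∞) * h n * ENNReal.ofReal (1 + t) ^ n ≤ ENNReal.ofReal d := by
    calc ∑' n : ℕ, (n : ℝ≥0∞) * h n * ENNReal.ofReal (1 + t) ^ n
        ≤ ∑' n : ℕ, ((n : ℝ≥0∞) * h n +
            ENNReal.ofReal t * ((n : ℝ≥0∞) ^ 2 * h n * ENNReal.ofReal y ^ n)) := by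
          refine ENNReal.tsum_le_tsum fun n => ?_
          calc (n : ℝ≥0∞) * h n * ENNReal.ofReal (1 + t) ^ n
              ≤ (n : ℝ≥0∞) * h n * (1 + n * (ENNReal.ofReal t * ENNReal.ofReal y ^ n)) := by
                refine mul_le_mul_right ((hpow n).trans ?_) _
                gcongr
            _ = _ := by ring
      _ = l + ENNReal.ofReal t * M := by rw [ENNReal.tsum_add, ENNReal.tsum_mul_left]
      _ = ENNReal.ofReal d := by
          rw [hd, ENNReal.ofReal_add ENNReal.toReal_nonneg (by positivity),
            ENNReal.ofReal_mul ht0.le, ENNReal.ofReal_toReal hM.ne,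
            ENNReal.ofReal_toReal (hl.trans ENNReal.one_lt_top).ne]
  have hgen : ∑' n, h n * ENNReal.ofReal (1 + t) ^ n ≤ ENNReal.ofReal (1 + t * d) := by
    calc ∑' n, h n * ENNReal.ofReal (1 + t) ^ n
        ≤ ∑' n, (h n + ENNReal.ofReal t * ((n : ℝ≥0∞) * h n * ENNReal.ofReal (1 + t) ^ n)) := by
          refine ENNReal.tsum_le_tsum fun n => (mul_le_mul_right (hpow n) _).trans_eq ?_
          ring
      _ = 1 + ENNReal.ofReal t * ∑' n : ℕ, (n : ℝ≥0∞) * h n * ENNReal.ofReal (1 + t) ^ n := by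
          rw [ENNReal.tsum_add, ENNReal.tsum_mul_left, h.tsum_coe]
      _ ≤ 1 + ENNReal.ofReal t * ENNReal.ofReal d := by gcongr
      _ = ENNReal.ofReal (1 + t * d) := by
          rw [ENNReal.ofReal_add zero_le_one (by positivity), ENNReal.ofReal_mul ht0.le,
            ENNReal.ofReal_one]
  have htd : 0 < 1 + t * d := by positivity
  refine ⟨(1 + t) / (1 + t * d), 1 + t, ?_, by linarith, ?_, hder.trans_lt ENNReal.ofReal_lt_top⟩
  · rw [one_lt_div htd]
    nlinarith
  · refine (mul_le_mul_right hgen _).trans_eq ?_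
    rw [← ENNReal.ofReal_mul (by positivity), div_mul_cancel₀ _ htd.ne']

end Offspring

section Size

/-- The number of vertices of the Galton-Watson tree at distance at most `r` from the root. -/
def sizeTo : ℕ → Marks → ℕ
  | 0, _ => 1
  | r + 1, e => 1 + ∑ j ∈ Finset.range (kids e), sizeTo r (sub j e)

theorem measurable_sizeTo (r : ℕ) : Measurable (sizeTo r) := by
  induction r with
  | zero => exact measurable_const
  | succ r ih =>
    have h1 : Measurable fun p : ℕ × Marks => 1 + ∑ j ∈ Finset.range p.1, sizeTo r (sub j p.2) := by
      refine measurable_from_prod_countable_right fun n => ?_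
      exact measurable_const.add (Finset.measurable_sum (Finset.range n)
        fun j _ => ih.comp (measurable_sub j) : Measurable fun e : Marks =>
          ∑ j ∈ Finset.range n, sizeTo r (sub j e))
    exact h1.comp (measurable_kids.prodMk measurable_id)

theorem sizeTo_le_succ (r : ℕ) (e : Marks) : sizeTo r e ≤ sizeTo (r + 1) e := by
  induction r generalizing e with
  | zero => exact Nat.le_add_right _ _
  | succ r ih => exact Nat.add_le_add_left (Finset.sum_le_sum fun j _ => ih (sub j e)) 1

/-- No finiteness of the tree is assumed, so that bounds on `sizeTo` yield finiteness. -/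
theorem card_le_sizeTo {r : ℕ} {e : Marks} {S : Finset Label} (hS : ↑S ⊆ markVerts e)
    (hr : ∀ v ∈ S, v.length ≤ r) : S.card ≤ sizeTo r e := by
  induction r generalizing e S with
  | zero =>
    refine Finset.card_le_one.2 fun v hv w hw => ?_
    rw [List.length_eq_zero_iff.1 (Nat.le_zero.1 (hr v hv)),
      List.length_eq_zero_iff.1 (Nat.le_zero.1 (hr w hw))]
  | succ r ih =>
    let S' : ℕ → Finset Label := fun j => S.preimage (List.cons j) List.cons_injective.injOn
    have hsub : S ⊆ {[]} ∪ (Finset.range (kids e)).biUnion fun j => (S' j).image (List.cons j) := by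
      intro v hv
      cases v with
      | nil => simp
      | cons j v =>
        have hj := (cons_mem_markVerts.1 (hS hv)).1
        simp only [Finset.mem_union, Finset.mem_biUnion, Finset.mem_image, Finset.mem_range]
        exact Or.inr ⟨j, hj, v, by simpa [S'] using hv, rfl⟩
    refine (Finset.card_le_card hsub).trans ((Finset.card_union_le _ _).trans ?_)
    refine add_le_add (by simp) (Finset.card_biUnion_le.trans (Finset.sum_le_sum fun j _ => ?_))
    refine Finset.card_image_le.trans (ih (fun v hv => ?_) fun v hv => ?_)
    · exact (cons_mem_markVerts.1 (hS (Finset.mem_preimage.1 hv))).2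
    · have := hr _ (Finset.mem_preimage.1 hv)
      simpa using this

theorem exists_sizeTo_ge {e : Marks} (he : (markVerts e).Infinite) (B : ℕ) :
    ∃ r, B ≤ sizeTo r e := by
  obtain ⟨S, hS, hc⟩ := he.exists_subset_card_eq B
  refine ⟨S.sup List.length, hc ▸ card_le_sizeTo hS fun v hv => ?_⟩
  exact Finset.le_sup (f := List.length) hv

theorem sz_le_sizeTo {e : Marks} (he : (markVerts e).Finite) : sz e ≤ sizeTo (dep e) e :=
  card_le_sizeTo (fun _ hv => (mem_verts he).1 hv) fun _ hv => (markTree e).length_le_depth hv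

variable (h : PMF ℕ) (ν : Measure ℝ) [IsProbabilityMeasure ν] {a x : ℝ} (ha : 1 < a) (hx : 1 < x)
  (hax : ENNReal.ofReal a * ∑' n, h n * ENNReal.ofReal x ^ n ≤ ENNReal.ofReal x)
include hx hax

theorem lintegral_pow_sizeTo_le (r : ℕ) :
    ∫⁻ e, ENNReal.ofReal a ^ sizeTo r e ∂markLaw h ν ≤ ENNReal.ofReal x := by
  have hx1 : 1 ≤ ENNReal.ofReal x := ENNReal.one_le_ofReal.2 hx.le
  induction r with
  | zero =>
    simp only [sizeTo, pow_one, lintegral_const, measure_univ, mul_one]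
    refine le_trans ?_ hax
    have h1 : 1 ≤ ∑' n, h n * ENNReal.ofReal x ^ n := by
      rw [← h.tsum_coe]
      exact ENNReal.tsum_le_tsum fun n => le_mul_of_one_le_right' (one_le_pow₀ hx1)
    exact le_mul_of_one_le_right' h1
  | succ r ih =>
    have hG : Measurable fun e => ENNReal.ofReal a ^ sizeTo r e :=
      (measurable_of_countable fun k : ℕ => ENNReal.ofReal a ^ k).comp (measurable_sizeTo r)
    refine le_trans ?_ hax
    rw [lintegral_eq_tsum_kids, ← ENNReal.tsum_mul_left]
    refine ENNReal.tsum_le_tsum fun n => ?_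
    let F : (Fin n → Marks) → ℝ≥0∞ := fun f =>
      ENNReal.ofReal a * ∏ j, ENNReal.ofReal a ^ sizeTo r (f j)
    have hF : Measurable fun f : Fin n → Marks => ∏ j, ENNReal.ofReal a ^ sizeTo r (f j) :=
      Finset.measurable_prod _ fun j _ => hG.comp (measurable_pi_apply j)
    have h1 : ∫⁻ e in {e | kids e = n}, ENNReal.ofReal a ^ sizeTo (r + 1) e ∂markLaw h ν =
        ∫⁻ e in {e | kids e = n}, F (fun j => sub (j : ℕ) e) ∂markLaw h ν := by
      refine setLIntegral_congr_fun (measurable_kids (measurableSet_singleton n)) fun e he => ?_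
      have he' : kids e = n := he
      simp only [F, sizeTo, he', pow_add, pow_one, Finset.sum_range, Finset.prod_pow_eq_pow_sum]
    rw [h1, setLIntegral_kids_eq h ν n (hF.const_mul _), lintegral_const_mul _ hF,
      lintegral_pi_prod h ν hG]
    calc h n * (ENNReal.ofReal a * (∫⁻ e, ENNReal.ofReal a ^ sizeTo r e ∂markLaw h ν) ^ n)
        ≤ h n * (ENNReal.ofReal a * ENNReal.ofReal x ^ n) := by gcongr
      _ = _ := by ring

include ha

theorem lintegral_iSup_pow_sizeTo_le :
    ∫⁻ e, ⨆ r, ENNReal.ofReal a ^ sizeTo r e ∂markLaw h ν ≤ ENNReal.ofReal x := by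
  rw [lintegral_iSup]
  · exact iSup_le fun r => lintegral_pow_sizeTo_le h ν hx hax r
  · exact fun r => (measurable_of_countable fun k : ℕ => ENNReal.ofReal a ^ k).comp
      (measurable_sizeTo r)
  · exact fun i j hij e => pow_le_pow_right₀ (ENNReal.one_le_ofReal.2 ha.le)
      (monotone_nat_of_le_succ (f := fun r => sizeTo r e) (fun r => sizeTo_le_succ r e) hij)

theorem ae_finite_markVerts : ∀ᵐ e ∂markLaw h ν, (markVerts e).Finite := by
  have hm : Measurable fun e => ⨆ r, ENNReal.ofReal a ^ sizeTo r e := Measurable.iSup fun r =>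
    (measurable_of_countable fun k : ℕ => ENNReal.ofReal a ^ k).comp (measurable_sizeTo r)
  have hlt := ae_lt_top hm ((lintegral_iSup_pow_sizeTo_le h ν ha hx hax).trans_lt
    ENNReal.ofReal_lt_top).ne
  filter_upwards [hlt] with e he
  by_contra hinf
  obtain ⟨B, hB⟩ := pow_unbounded_of_one_lt (⨆ r, ENNReal.ofReal a ^ sizeTo r e).toReal ha
  obtain ⟨r, hr⟩ := exists_sizeTo_ge hinf B
  refine hB.not_ge ?_
  have h1 : ENNReal.ofReal (a ^ B) ≤ ⨆ r, ENNReal.ofReal a ^ sizeTo r e := by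
    rw [ENNReal.ofReal_pow (by linarith)]
    exact (pow_le_pow_right₀ (ENNReal.one_le_ofReal.2 ha.le) hr).trans
      (le_iSup (fun r => ENNReal.ofReal a ^ sizeTo r e) r)
  exact (ENNReal.ofReal_le_iff_le_toReal he.ne).1 h1

/-- The size of the tree has an exponential moment. -/
theorem lintegral_pow_sz_le :
    ∫⁻ e, ENNReal.ofReal a ^ sz e ∂markLaw h ν ≤ ENNReal.ofReal x := by
  refine le_trans (lintegral_mono_ae ?_) (lintegral_iSup_pow_sizeTo_le h ν ha hx hax)
  filter_upwards [ae_finite_markVerts h ν ha hx hax] with e he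
  exact (pow_le_pow_right₀ (ENNReal.one_le_ofReal.2 ha.le) (sz_le_sizeTo he)).trans
    (le_iSup (fun r => ENNReal.ofReal a ^ sizeTo r e) _)

end Size

/-! ### Depth of the tree, and planting above a new root -/

/-- The event that the total weight exceeds `u` and that the depth is at least `s`. -/
def heavyDeep (u : ℝ) (s : ℕ) : Set Marks := {e | u < wt e ∧ s ≤ dep e}

/-- The mean of the offspring law. -/
def offspringMean (h : PMF ℕ) : ℝ≥0∞ := ∑' k : ℕ, (k : ℝ≥0∞) * h k

theorem measurableSet_heavyDeep (u : ℝ) (s : ℕ) : MeasurableSet (heavyDeep u s) :=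
  (measurableSet_lt measurable_const measurable_wt).inter
    (measurableSet_le measurable_const measurable_dep)

theorem sz_eq_one_of_kids {e : Marks} (he : (markVerts e).Finite) (h0 : kids e = 0) :
    sz e = 1 := by
  rw [sz_eq he, h0]
  simp

section Children

variable (h : PMF ℕ) (ν : Measure ℝ) [IsProbabilityMeasure ν]

theorem measure_kids_eq_sub {n : ℕ} (j : Fin n) {A : Set Marks} (hA : MeasurableSet A) :
    markLaw h ν {e | kids e = n ∧ sub (j : ℕ) e ∈ A} = h n * markLaw h ν A := by
  have h1 := measure_kids_eq_inter h ν n (measurable_pi_apply j hA :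
    MeasurableSet ((fun f : Fin n → Marks => f j) ⁻¹' A))
  rw [(measurePreserving_eval (fun _ : Fin n => markLaw h ν) j).measure_preimage
    hA.nullMeasurableSet] at h1
  exact h1

theorem measure_kids_eq_sub_sub {n : ℕ} {j l : Fin n} (hjl : j ≠ l) {A : Set (Marks × Marks)}
    (hA : MeasurableSet A) :
    markLaw h ν {e | kids e = n ∧ (sub (j : ℕ) e, sub (l : ℕ) e) ∈ A} =
      h n * ((markLaw h ν).prod (markLaw h ν)) A := by
  have hm : Measurable fun f : Fin n → Marks => (f j, f l) := by fun_prop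
  have h1 := measure_kids_eq_inter h ν n (hm hA)
  rw [← Measure.map_apply hm hA, ← Measure.infinitePi_eq_pi,
    Measure.infinitePi_map_eval_prod hjl] at h1
  exact h1

end Children

section Depth

variable {h : PMF ℕ} {ν : Measure ℝ} [IsProbabilityMeasure ν] {q Q : ℝ}
  (hreg : ∀ᵐ e ∂markLaw h ν, Regular q Q e)
include hreg

theorem measure_le_dep_succ (b : ℕ) :
    markLaw h ν {e | b + 1 ≤ dep e} ≤ offspringMean h * markLaw h ν {e | b ≤ dep e} := by
  have hm : ∀ b, MeasurableSet {e | b ≤ dep e} := fun b =>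
    measurableSet_le measurable_const measurable_dep
  rw [measure_eq_tsum_kids _ (hm _), offspringMean, ← ENNReal.tsum_mul_right]
  refine ENNReal.tsum_le_tsum fun n => ?_
  calc markLaw h ν {e | kids e = n ∧ b + 1 ≤ dep e}
      ≤ markLaw h ν (⋃ j : Fin n, {e | kids e = n ∧ sub (j : ℕ) e ∈ {e | b ≤ dep e}}) := by
        refine measure_mono_ae ?_
        filter_upwards [hreg] with e he
        rintro ⟨hk, hd⟩
        have hn : 0 < n := by
          by_contra h0
          have := dep_eq_zero he.1 (by omega : kids e = 0)
          omega
        obtain ⟨j, hj⟩ := exists_isSpine hn fun l : Fin n => sub (l : ℕ) e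
        refine Set.mem_iUnion.2 ⟨j, hk, ?_⟩
        have := dep_eq_of_isSpine he.1 hk hj
        show b ≤ dep (sub (j : ℕ) e)
        omega
    _ ≤ ∑ j : Fin n, markLaw h ν {e | kids e = n ∧ sub (j : ℕ) e ∈ {e | b ≤ dep e}} :=
        measure_iUnion_fintype_le _ _
    _ = n * h n * markLaw h ν {e | b ≤ dep e} := by
        simp only [measure_kids_eq_sub h ν _ (hm b)]
        simp [mul_assoc]

/-- Extinction is geometric: to reach `a` more generations costs a factor `(mean)^a`. -/
theorem measure_le_dep_add (a b : ℕ) :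
    markLaw h ν {e | a + b ≤ dep e} ≤ offspringMean h ^ a * markLaw h ν {e | b ≤ dep e} := by
  induction a with
  | zero => simp
  | succ a ih =>
    have h1 : a + 1 + b = a + b + 1 := by ring
    rw [h1, pow_succ', mul_assoc]
    exact (measure_le_dep_succ hreg _).trans (by gcongr)

end Depth

section Lift

variable {h : PMF ℕ} {ν : Measure ℝ} [IsProbabilityMeasure ν] {q Q : ℝ} (hq : 1 < q)
  (hreg : ∀ᵐ e ∂markLaw h ν, Regular q Q e)
include hq hreg

/-- Planting the tree above a new root whose other children are childless multiplies the weight by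
at least `q`, adds one generation and creates an outgrowth of at most `m` vertices at the root. -/
theorem measure_plant_le {m : ℕ} (hm : 1 ≤ m) (u : ℝ) (s : ℕ) :
    h m * h 0 ^ (m - 1) * markLaw h ν {e | u < q * wt e ∧ s ≤ dep e} ≤
      markLaw h ν (heavyDeep u (s + 1) ∩ {e | og 0 e ≤ m}) := by
  obtain ⟨m, rfl⟩ : ∃ k, m = k + 1 := ⟨m - 1, by omega⟩
  set B : Set Marks := {e | u < q * wt e ∧ s ≤ dep e} with hB
  have hBm : MeasurableSet B :=
    (measurableSet_lt measurable_const (measurable_wt.const_mul q)).inter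
      (measurableSet_le measurable_const measurable_dep)
  have hZm : MeasurableSet {e : Marks | kids e = 0} := measurable_kids (measurableSet_singleton 0)
  let A : Fin (m + 1) → Set Marks := fun j => if j = 0 then B else {e | kids e = 0}
  have hA : ∀ j, MeasurableSet (A j) := fun j => by
    by_cases hj : j = 0
    · simpa [A, hj] using hBm
    · simpa [A, hj] using hZm
  have hpi : (Measure.pi fun _ : Fin (m + 1) => markLaw h ν) (Set.univ.pi A) =
      h 0 ^ m * markLaw h ν B := by
    rw [Measure.pi_pi, Fin.prod_univ_succ]
    simp [A, Fin.succ_ne_zero, measure_kids_eq, mul_comm]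
  have h1 := measure_kids_eq_inter h ν (m + 1) (MeasurableSet.univ_pi hA)
  rw [hpi] at h1
  rw [Nat.add_sub_cancel, mul_assoc, ← h1]
  refine measure_mono_ae ?_
  filter_upwards [hreg] with e he
  rintro ⟨hk, hf⟩
  have hf0 : sub 0 e ∈ B := by simpa [A] using hf 0 trivial
  have hfl : ∀ l : Fin (m + 1), l ≠ 0 → kids (sub (l : ℕ) e) = 0 := fun l hl => by
    have := hf l trivial
    simpa [A, hl] using this
  have hsub : ∀ l : Fin (m + 1), Regular q Q (sub (l : ℕ) e) := fun l => he.sub (by rw [hk]; exact l.2)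
  have hspine : IsSpine (fun l : Fin (m + 1) => sub (l : ℕ) e) 0 := by
    refine ⟨fun l hl => absurd hl (Fin.not_lt_zero l), fun l => ?_⟩
    by_cases hl : l = 0
    · rw [hl]
    · simp [dep_eq_zero (hsub l).1 (hfl l hl)]
  have hdep := dep_eq_of_isSpine he.1 hk hspine
  have hog := og_zero_of_isSpine he.1 hk hspine
  have hpos : ∀ l : Fin (m + 1), 0 ≤ rootBias (sub (l : ℕ) e) * wt (sub (l : ℕ) e) := fun l =>
    mul_nonneg (by have := ((hsub l).2 []).1; unfold rootBias; linarith)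
      (by have := one_le_wt (hsub l) hq.le; linarith)
  refine ⟨⟨?_, ?_⟩, ?_⟩
  · rw [wt_eq he.1, hk, Finset.sum_range]
    have h2 : rootBias (sub 0 e) * wt (sub 0 e) ≤
        ∑ l : Fin (m + 1), rootBias (sub (l : ℕ) e) * wt (sub (l : ℕ) e) :=
      Finset.single_le_sum (f := fun l : Fin (m + 1) =>
        rootBias (sub (l : ℕ) e) * wt (sub (l : ℕ) e)) (fun l _ => hpos l) (Finset.mem_univ 0)
    have h3 : q * wt (sub 0 e) ≤ rootBias (sub 0 e) * wt (sub 0 e) := by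
      have h4 := one_le_wt (hsub 0) hq.le
      have h5 := ((hsub 0).2 []).1
      simp only [Fin.val_zero] at h4 h5
      unfold rootBias
      gcongr
    linarith [hf0.1]
  · rw [hdep]
    exact Nat.succ_le_succ hf0.2
  · refine hog.trans ?_
    rw [Finset.sum_congr rfl fun l hl =>
      sz_eq_one_of_kids (hsub l).1 (hfl l (Finset.ne_of_mem_erase hl))]
    simp [add_comm]

theorem measure_plant_iterate_le {m : ℕ} (hm : 1 ≤ m) (M : ℕ) (u : ℝ) (s : ℕ) :
    (h m * h 0 ^ (m - 1)) ^ M * markLaw h ν {e | u < q ^ M * wt e ∧ s ≤ dep e} ≤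
      markLaw h ν (heavyDeep u (s + M)) := by
  induction M generalizing s with
  | zero => simp [heavyDeep]
  | succ M ih =>
    have hqM : 0 < q ^ M := by positivity
    have h1 : {e | u < q ^ (M + 1) * wt e ∧ s ≤ dep e} =
        {e | u / q ^ M < q * wt e ∧ s ≤ dep e} := by
      ext e
      simp only [Set.mem_ofPred_eq, div_lt_iff₀ hqM]
      rw [show q * wt e * q ^ M = q ^ (M + 1) * wt e by ring]
    have h2 : heavyDeep (u / q ^ M) (s + 1) = {e | u < q ^ M * wt e ∧ s + 1 ≤ dep e} := by
      ext e
      simp only [heavyDeep, Set.mem_ofPred_eq, div_lt_iff₀ hqM, mul_comm]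
    rw [h1, pow_succ, mul_assoc]
    calc _ ≤ (h m * h 0 ^ (m - 1)) ^ M * markLaw h ν (heavyDeep (u / q ^ M) (s + 1)) := by
          gcongr
          exact (measure_plant_le hq hreg hm _ _).trans (measure_mono Set.inter_subset_left)
      _ ≤ markLaw h ν (heavyDeep u (s + 1 + M)) := by rw [h2]; exact ih _
      _ = _ := by rw [show s + 1 + M = s + (M + 1) by ring]

/-- Lowering the level `u` by a factor `y` increases the probability of `{ω(T) > u, D(T) ≥ s}` at
most polynomially in `y`, even if one generation is given away. -/
theorem exists_measure_mul_wt_le {m : ℕ} (hm : 1 ≤ m) (hhm : h m ≠ 0) (hh0 : h 0 ≠ 0) :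
    ∃ (C : ℝ≥0∞) (p : ℕ), C ≠ ⊤ ∧ ∀ (y : ℝ) (u : ℝ) (s : ℕ), 1 ≤ y →
      markLaw h ν {e | u < y * wt e ∧ s ≤ dep e + 1} ≤
        C * ENNReal.ofReal y ^ p * markLaw h ν (heavyDeep u s) := by
  set δ := h m * h 0 ^ (m - 1) with hδ
  have hδ0 : δ ≠ 0 := mul_ne_zero hhm (pow_ne_zero _ hh0)
  have hδt : δ ≠ ⊤ := ENNReal.mul_ne_top (h.apply_ne_top _) (ENNReal.pow_ne_top (h.apply_ne_top _))
  -- each planting gains a factor `q` in weight and costs `δ⁻¹ ≤ q ^ p` in probability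
  obtain ⟨p, hp⟩ := pow_unbounded_of_one_lt (δ⁻¹).toReal hq
  have hp' : δ⁻¹ ≤ ENNReal.ofReal q ^ p := by
    rw [← ENNReal.ofReal_pow (by linarith)]
    exact (ENNReal.le_ofReal_iff_toReal_le (ENNReal.inv_ne_top.2 hδ0) (by positivity)).2 hp.le
  refine ⟨ENNReal.ofReal q ^ p, p, ENNReal.pow_ne_top ENNReal.ofReal_ne_top, fun y u s hy => ?_⟩
  obtain ⟨n, hn1, hn2⟩ := exists_nat_pow_near hy hq
  -- at least one planting takes place, which makes up for the generation given away
  have h1 : markLaw h ν {e | u < y * wt e ∧ s ≤ dep e + 1} ≤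
      markLaw h ν {e | u < q ^ (n + 1) * wt e ∧ s - 1 ≤ dep e} := by
    refine measure_mono_ae ?_
    filter_upwards [hreg] with e he
    rintro ⟨h1, h2⟩
    have := one_le_wt he hq.le
    exact ⟨h1.trans_le (by gcongr), by omega⟩
  have h2 := measure_plant_iterate_le hq hreg hm (n + 1) u (s - 1)
  have h3 : markLaw h ν (heavyDeep u (s - 1 + (n + 1))) ≤ markLaw h ν (heavyDeep u s) :=
    measure_mono fun e he => ⟨he.1, by have := he.2; omega⟩
  have h4 : δ⁻¹ ^ (n + 1) ≤ ENNReal.ofReal q ^ p * ENNReal.ofReal y ^ p := by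
    calc δ⁻¹ ^ (n + 1) ≤ (ENNReal.ofReal q ^ p) ^ (n + 1) := by gcongr
      _ = ENNReal.ofReal q ^ p * (ENNReal.ofReal q ^ n) ^ p := by ring
      _ ≤ _ := by
        gcongr
        rw [← ENNReal.ofReal_pow (by linarith)]
        exact ENNReal.ofReal_le_ofReal hn1
  calc markLaw h ν {e | u < y * wt e ∧ s ≤ dep e + 1}
      ≤ markLaw h ν {e | u < q ^ (n + 1) * wt e ∧ s - 1 ≤ dep e} := h1
    _ = δ⁻¹ ^ (n + 1) * (δ ^ (n + 1) *
          markLaw h ν {e | u < q ^ (n + 1) * wt e ∧ s - 1 ≤ dep e}) := by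
        rw [← mul_assoc, ← mul_pow, ENNReal.inv_mul_cancel hδ0 hδt, one_pow, one_mul]
    _ ≤ _ := mul_le_mul' h4 (h2.trans h3)

end Lift

/-! ### Comparison along the spine, and grafting -/

/-- A set of marks which depends on the unweighted tree only. -/
def VertsDetermined (X : Set Marks) : Prop :=
  ∀ e e', (markTree e).verts = (markTree e').verts → (e ∈ X ↔ e' ∈ X)

theorem VertsDetermined.measurableSet {X : Set Marks} (hX : VertsDetermined X) :
    MeasurableSet X := by
  have hm : Measurable fun e => e ∈ X := measurable_of_verts fun e e' h => propext (hX e e' h)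
  exact measurableSet_setOfPred.2 hm

theorem dep_congr {e e' : Marks} (h : (markTree e).verts = (markTree e').verts) :
    dep e = dep e' := by
  unfold dep WeightedTree.depth
  rw [h]

theorem og_congr (i : ℕ) {e e' : Marks} (h : (markTree e).verts = (markTree e').verts) :
    og i e = og i e' := by
  unfold og
  rw [WeightedTree.side_congr h]

section RootBias

theorem verts_setBias (e : Marks) (x : ℝ) :
    (markTree (setBias (e, x))).verts = (markTree e).verts := by
  have h1 : (fun v => (setBias (e, x) v).1) = fun v => (e v).1 := by
    ext v
    cases v <;> rfl
  unfold markTree gwTree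
  simp only [h1]
  split_ifs <;> rfl

theorem wt_setBias (e : Marks) (x : ℝ) : wt (setBias (e, x)) = wt e := by
  unfold wt WeightedTree.weight
  rw [verts_setBias]
  refine Finset.sum_congr rfl fun v _ => Finset.prod_congr rfl fun j hj => ?_
  rw [bias_markTree, bias_markTree]
  cases v with
  | nil => simp at hj
  | cons k v => rfl

theorem rootBias_setBias (e : Marks) (x : ℝ) : rootBias (setBias (e, x)) = x := rfl

end RootBias

section Transfer

/-- On each of the events `{ω(T) > u, D(T) ≥ s}`, the event `X` is at least `c` times less likely
than the event `X'`. -/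
def Dominated (P : Measure Marks) (c : ℝ≥0∞) (X X' : Set Marks) : Prop :=
  ∀ u s, c * P (heavyDeep u s ∩ X) ≤ P (heavyDeep u s ∩ X')

variable {h : PMF ℕ} {ν : Measure ℝ} [IsProbabilityMeasure ν] {q Q : ℝ}

/-- A comparison of probabilities stays true if the weight is multiplied by the bias of the edge to
the parent of the root, as this bias is independent of the tree. -/
theorem Dominated.mul_rootBias (hν : ∀ᵐ x ∂ν, 0 < x) {c : ℝ≥0∞} {X X' : Set Marks}
    (hX : VertsDetermined X) (hX' : VertsDetermined X') (hd : Dominated (markLaw h ν) c X X')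
    (u : ℝ) (s : ℕ) :
    c * markLaw h ν {e | u < rootBias e * wt e ∧ s ≤ dep e ∧ e ∈ X} ≤
      markLaw h ν {e | u < rootBias e * wt e ∧ s ≤ dep e ∧ e ∈ X'} := by
  have key : ∀ Z : Set Marks, VertsDetermined Z →
      markLaw h ν {e | u < rootBias e * wt e ∧ s ≤ dep e ∧ e ∈ Z} =
        ∫⁻ x, markLaw h ν (heavyDeep (u / x) s ∩ Z) ∂ν := by
    intro Z hZ
    have hm : MeasurableSet {e : Marks | u < rootBias e * wt e ∧ s ≤ dep e ∧ e ∈ Z} :=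
      (measurableSet_lt measurable_const (measurable_rootBias.mul measurable_wt)).inter
        ((measurableSet_le measurable_const measurable_dep).inter hZ.measurableSet)
    have hmp := measurePreserving_setBias h.toMeasure ν
    rw [← hmp.measure_preimage hm.nullMeasurableSet,
      Measure.prod_apply_symm (hmp.measurable hm)]
    refine lintegral_congr_ae ?_
    filter_upwards [hν] with x hx
    congr 1
    ext e
    simp only [Set.mem_preimage, Set.mem_ofPred_eq, rootBias_setBias, wt_setBias,
      dep_congr (verts_setBias e x), hZ _ _ (verts_setBias e x), heavyDeep, Set.mem_inter_iff,
      div_lt_iff₀ hx, mul_comm x, and_assoc]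
  rw [key X hX, key X' hX']
  exact (lintegral_const_mul_le _ _).trans (lintegral_mono fun x => hd _ _)

theorem measurableSet_isSpine {n : ℕ} (j : Fin n) :
    MeasurableSet {f : Fin n → Marks | IsSpine f j} := by
  have hd : ∀ l : Fin n, Measurable fun f : Fin n → Marks => dep (f l) := fun l =>
    measurable_dep.comp (measurable_pi_apply l)
  unfold IsSpine
  refine MeasurableSet.inter (s₁ := {f : Fin n → Marks | ∀ l < j, dep (f l) < dep (f j)})
    (s₂ := {f : Fin n → Marks | ∀ l, dep (f l) ≤ dep (f j)}) ?_ ?_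
  · rw [Set.ofPred_forall]
    refine MeasurableSet.iInter fun l => ?_
    rw [Set.ofPred_forall]
    exact MeasurableSet.iInter fun _ => measurableSet_lt (hd l) (hd j)
  · rw [Set.ofPred_forall]
    exact MeasurableSet.iInter fun l => measurableSet_le (hd l) (hd j)

/-- The trees `f` hang from the children of a root whose tree is heavy and deep; the path to the
base vertex passes through the `j`-th, which lies in `X`. -/
def spineEvent (u : ℝ) (s : ℕ) (X : Set Marks) {n : ℕ} (j : Fin n) : Set (Fin n → Marks) :=
  {f | IsSpine f j ∧ u < 1 + ∑ l, rootBias (f l) * wt (f l) ∧ s ≤ dep (f j) + 1 ∧ f j ∈ X}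

theorem measurableSet_spineEvent (u : ℝ) (s : ℕ) {X : Set Marks} (hX : MeasurableSet X) {n : ℕ}
    (j : Fin n) : MeasurableSet (spineEvent u s X j) := by
  refine (measurableSet_isSpine j).inter (MeasurableSet.inter ?_ (MeasurableSet.inter ?_ ?_))
  · have hs : Measurable fun f : Fin n → Marks => ∑ l, rootBias (f l) * wt (f l) :=
      Finset.measurable_sum _ fun l _ =>
        (measurable_rootBias.mul measurable_wt).comp (measurable_pi_apply l)
    exact measurableSet_lt measurable_const (hs.const_add 1)
  · have hd : Measurable fun f : Fin n → Marks => dep (f j) + 1 :=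
      (measurable_dep.comp (measurable_pi_apply j)).add measurable_const
    exact measurableSet_le measurable_const hd
  · exact measurable_pi_apply j hX

/-- Given its siblings, being the spine child is a lower bound on the depth. -/
theorem isSpine_insertNth_iff {n : ℕ} (j : Fin (n + 1)) (x : Marks) (f : Fin n → Marks) :
    IsSpine (j.insertNth x f : Fin (n + 1) → Marks) j ↔
      (Finset.univ.sup fun l => dep (f l) + if j.succAbove l < j then 1 else 0) ≤ dep x := by
  unfold IsSpine
  simp only [Fin.insertNth_apply_same, Finset.sup_le_iff, Finset.mem_univ, forall_const,
    j.forall_iff_succAbove, Fin.insertNth_apply_succAbove, lt_irrefl, false_imp_iff, true_and,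
    le_refl, ← forall_and]
  refine forall_congr' fun l => ?_
  split_ifs with hl
  · simp only [hl, true_imp_iff, Nat.succ_le_iff]
    exact ⟨fun h => h.1, fun h => ⟨h, h.le⟩⟩
  · simp [hl]

/-- Given the siblings of the spine child, the spine child is only asked to be heavy and deep. -/
theorem Dominated.measure_spineEvent_le (hν : ∀ᵐ x ∂ν, 0 < x) {c : ℝ≥0∞} {X X' : Set Marks}
    (hX : VertsDetermined X) (hX' : VertsDetermined X') (hd : Dominated (markLaw h ν) c X X')
    (u : ℝ) (s : ℕ) {n : ℕ} (j : Fin n) :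
    c * Measure.pi (fun _ : Fin n => markLaw h ν) (spineEvent u s X j) ≤
      Measure.pi (fun _ : Fin n => markLaw h ν) (spineEvent u s X' j) := by
  obtain ⟨n, rfl⟩ : ∃ k, n = k + 1 := ⟨n - 1, by have := j.2; omega⟩
  have hmp := (measurePreserving_piFinSuccAbove (fun _ : Fin (n + 1) => markLaw h ν) j).symm
  have key : ∀ Z : Set Marks, VertsDetermined Z →
      Measure.pi (fun _ : Fin (n + 1) => markLaw h ν) (spineEvent u s Z j) =
        ∫⁻ f, markLaw h ν {e | u - 1 - ∑ l, rootBias (f l) * wt (f l) < rootBias e * wt e ∧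
          max (s - 1) (Finset.univ.sup fun l => dep (f l) + if j.succAbove l < j then 1 else 0) ≤
            dep e ∧ e ∈ Z} ∂(Measure.pi fun _ : Fin n => markLaw h ν) := by
    intro Z hZ
    have hm := measurableSet_spineEvent u s hZ.measurableSet j
    rw [← hmp.measure_preimage hm.nullMeasurableSet,
      Measure.prod_apply_symm (hmp.measurable hm)]
    refine lintegral_congr fun f => ?_
    congr 1
    ext e
    have hsp := isSpine_insertNth_iff j e f
    simp only [spineEvent, Set.mem_preimage, Set.mem_ofPred_eq,
      MeasurableEquiv.piFinSuccAbove_symm_apply, Fin.insertNthEquiv_apply,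
      Fin.sum_univ_succAbove _ j, Fin.insertNth_apply_same, Fin.insertNth_apply_succAbove,
      max_le_iff]
    constructor
    · rintro ⟨h1, h2, h3, h4⟩
      exact ⟨by linarith, ⟨by omega, hsp.1 h1⟩, h4⟩
    · rintro ⟨h2, ⟨h3, h1⟩, h4⟩
      exact ⟨hsp.2 h1, by linarith, by omega, h4⟩
  rw [key X hX, key X' hX']
  exact (lintegral_const_mul_le _ _).trans
    (lintegral_mono fun f => hd.mul_rootBias hν hX hX' _ _)

/-- A comparison of probabilities passes from the tree of the spine child to the whole tree. -/
theorem Dominated.of_spine_child (hν : ∀ᵐ x ∂ν, 0 < x) (hreg : ∀ᵐ e ∂markLaw h ν, Regular q Q e)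
    {c : ℝ≥0∞} {X X' Y Y' : Set Marks} (hX : VertsDetermined X) (hX' : VertsDetermined X')
    (hY : VertsDetermined Y) (hY' : VertsDetermined Y') (hd : Dominated (markLaw h ν) c X X')
    (h0 : ∀ e, (markVerts e).Finite → kids e = 0 → e ∉ Y)
    (hYX : ∀ e, (markVerts e).Finite → ∀ j : Fin (kids e),
      IsSpine (fun l : Fin (kids e) => sub (l : ℕ) e) j → e ∈ Y → sub (j : ℕ) e ∈ X)
    (hXY : ∀ e, (markVerts e).Finite → ∀ j : Fin (kids e),
      IsSpine (fun l : Fin (kids e) => sub (l : ℕ) e) j → sub (j : ℕ) e ∈ X' → e ∈ Y') :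
    Dominated (markLaw h ν) c Y Y' := by
  intro u s
  have hmY := (measurableSet_heavyDeep u s).inter hY.measurableSet
  have hmY' := (measurableSet_heavyDeep u s).inter hY'.measurableSet
  rw [measure_eq_tsum_kids _ hmY, measure_eq_tsum_kids _ hmY', ← ENNReal.tsum_mul_left]
  refine ENNReal.tsum_le_tsum fun n => ?_
  have hms : Measurable fun (e : Marks) (j : Fin n) => sub (j : ℕ) e :=
    measurable_pi_lambda _ fun j => measurable_sub _
  have hmE : ∀ (Z : Set Marks), MeasurableSet Z → ∀ j : Fin n, MeasurableSet
      {e : Marks | kids e = n ∧ (fun l : Fin n => sub (l : ℕ) e) ∈ spineEvent u s Z j} :=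
    fun Z hZ j => (measurable_kids (measurableSet_singleton n)).inter
      (hms (measurableSet_spineEvent u s hZ j))
  calc c * markLaw h ν {e | kids e = n ∧ e ∈ heavyDeep u s ∩ Y}
      ≤ c * ∑ j : Fin n, markLaw h ν
          {e | kids e = n ∧ (fun l : Fin n => sub (l : ℕ) e) ∈ spineEvent u s X j} := by
        gcongr
        refine le_trans (measure_mono_ae ?_) (measure_iUnion_fintype_le _ _)
        filter_upwards [hreg] with e he
        rintro ⟨hk, ⟨hu, hs⟩, heY⟩
        subst hk
        have hn : 0 < kids e := Nat.pos_of_ne_zero fun h => h0 e he.1 h heY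
        obtain ⟨j, hj⟩ := exists_isSpine hn fun l : Fin (kids e) => sub (l : ℕ) e
        refine Set.mem_iUnion.2 ⟨j, rfl, hj, ?_, ?_, hYX e he.1 j hj heY⟩
        · rw [wt_eq he.1, Finset.sum_range] at hu
          exact hu
        · rw [dep_eq_of_isSpine he.1 rfl hj] at hs
          exact hs
    _ = ∑ j : Fin n, h n * (c * Measure.pi (fun _ : Fin n => markLaw h ν)
          (spineEvent u s X j)) := by
        rw [Finset.mul_sum]
        refine Finset.sum_congr rfl fun j _ => ?_
        rw [measure_kids_eq_inter h ν n (measurableSet_spineEvent u s hX.measurableSet j)]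
        ring
    _ ≤ ∑ j : Fin n, h n * Measure.pi (fun _ : Fin n => markLaw h ν) (spineEvent u s X' j) := by
        refine Finset.sum_le_sum fun j _ => ?_
        gcongr
        exact hd.measure_spineEvent_le hν hX hX' u s j
    _ = ∑ j : Fin n, markLaw h ν
          {e | kids e = n ∧ (fun l : Fin n => sub (l : ℕ) e) ∈ spineEvent u s X' j} := by
        refine Finset.sum_congr rfl fun j _ => ?_
        rw [measure_kids_eq_inter h ν n (measurableSet_spineEvent u s hX'.measurableSet j)]
    _ = markLaw h ν (⋃ j : Fin n,
          {e | kids e = n ∧ (fun l : Fin n => sub (l : ℕ) e) ∈ spineEvent u s X' j}) := by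
        rw [measure_iUnion _ (hmE X' hX'.measurableSet), tsum_fintype]
        intro j l hjl
        simp only [Function.onFun, Set.disjoint_left]
        exact fun e hj hl => hjl (hj.2.1.unique hl.2.1)
    _ ≤ markLaw h ν {e | kids e = n ∧ e ∈ heavyDeep u s ∩ Y'} := by
        refine measure_mono_ae ?_
        filter_upwards [hreg] with e he
        intro hmem
        obtain ⟨j, hk, hj, hu, hs, heX⟩ := Set.mem_iUnion.1 hmem
        subst hk
        refine ⟨rfl, ⟨?_, ?_⟩, hXY e he.1 j hj heX⟩
        · rw [wt_eq he.1, Finset.sum_range]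
          exact hu
        · rw [dep_eq_of_isSpine he.1 rfl hj]
          exact hs

end Transfer

section Graft

variable {h : PMF ℕ} {ν : Measure ℝ} [IsProbabilityMeasure ν] {q Q : ℝ} (hq : 1 < q)
  (hν : ∀ᵐ x ∂ν, q ≤ x ∧ x ≤ Q) (hreg : ∀ᵐ e ∂markLaw h ν, Regular q Q e)
include hq hν hreg

/-- Grafting: extending a tree of depth `d` by an independent tree of depth at least `b` at its base
vertex gives a tree of depth at least `d + b` whose weight is no smaller. -/
theorem dominated_graft (b d : ℕ) :
    Dominated (markLaw h ν) (markLaw h ν {e | b ≤ dep e}) {e | dep e = d} {e | d + b ≤ dep e} := by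
  have hν0 : ∀ᵐ x ∂ν, 0 < x := by
    filter_upwards [hν] with x hx
    linarith [hx.1]
  have hv1 : ∀ d, VertsDetermined {e | dep e = d} := fun d e e' he => by
    simp only [Set.mem_ofPred_eq, dep_congr he]
  have hv2 : ∀ d, VertsDetermined {e | d ≤ dep e} := fun d e e' he => by
    simp only [Set.mem_ofPred_eq, dep_congr he]
  induction d with
  | zero =>
    intro u s
    -- a tree of depth `0` weighs `1`, so the left side vanishes unless `u < 1` and `s = 0`
    by_cases hus : u < 1 ∧ s = 0
    · calc markLaw h ν {e | b ≤ dep e} * markLaw h ν (heavyDeep u s ∩ {e | dep e = 0})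
          ≤ markLaw h ν {e | b ≤ dep e} := mul_le_of_le_one_right' prob_le_one
        _ ≤ _ := by
          refine measure_mono_ae ?_
          filter_upwards [hreg] with e he
          intro hb
          refine ⟨⟨hus.1.trans_le (one_le_wt he hq.le), by omega⟩, ?_⟩
          show 0 + b ≤ dep e
          rw [zero_add]
          exact hb
    · have hz : markLaw h ν (heavyDeep u s ∩ {e | dep e = 0}) = 0 := by
        rw [measure_eq_zero_iff_ae_notMem]
        filter_upwards [hreg] with e he
        rintro ⟨⟨hu, hs⟩, hd⟩
        have hd' : dep e = 0 := hd
        have hk : kids e = 0 := by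
          by_contra hk
          have := dep_sub_lt he.1 (Nat.pos_of_ne_zero hk)
          omega
        rw [wt_eq he.1, hk] at hu
        simp at hu
        exact hus ⟨hu, by omega⟩
      rw [hz, mul_zero]
      exact zero_le
  | succ d ih =>
    refine ih.of_spine_child hν0 hreg (hv1 d) (hv2 _) (hv1 _) (hv2 _) ?_ ?_ ?_
    · intro e he hk hd
      have hd' : dep e = d + 1 := hd
      rw [dep_eq_zero he hk] at hd'
      omega
    · intro e he j hj hd
      have hd' : dep e = d + 1 := hd
      rw [dep_eq_of_isSpine he rfl hj] at hd'
      show dep (sub (j : ℕ) e) = d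
      omega
    · intro e he j hj hd
      have hd' : d + b ≤ dep (sub (j : ℕ) e) := hd
      show d + 1 + b ≤ dep e
      rw [dep_eq_of_isSpine he rfl hj]
      omega

/-- Two independent trees, of which the first is heavy and of depth at least `t`, and the second is
at least as deep as the first and of depth at least `s`, are exponentially in `t` less likely than
a single heavy tree of depth at least `s`: graft the second, shortened by the depth of the
first, onto the first. -/
theorem measure_two_trees_le (u : ℝ) (s t : ℕ) :
    ((markLaw h ν).prod (markLaw h ν))
        {p | u < wt p.1 ∧ t ≤ dep p.1 ∧ max s (dep p.1) ≤ dep p.2} ≤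
      offspringMean h ^ t * (1 - offspringMean h)⁻¹ * markLaw h ν (heavyDeep u s) := by
  have hsub : {p : Marks × Marks | u < wt p.1 ∧ t ≤ dep p.1 ∧ max s (dep p.1) ≤ dep p.2} ⊆
      ⋃ i : ℕ, (heavyDeep u 0 ∩ {e | dep e = t + i}) ×ˢ {e | max s (t + i) ≤ dep e} := by
    rintro ⟨x, y⟩ ⟨h1, h2, h3⟩
    have h4 : dep x = t + (dep x - t) := by simp only at h2; omega
    refine Set.mem_iUnion.2 ⟨dep x - t, ⟨⟨h1, Nat.zero_le _⟩, h4⟩, ?_⟩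
    show max s (t + (dep x - t)) ≤ dep y
    rw [← h4]
    exact h3
  refine (measure_mono hsub).trans ((measure_iUnion_le _).trans ?_)
  calc ∑' i, ((markLaw h ν).prod (markLaw h ν))
        ((heavyDeep u 0 ∩ {e | dep e = t + i}) ×ˢ {e | max s (t + i) ≤ dep e})
      ≤ ∑' i, offspringMean h ^ t * offspringMean h ^ i * markLaw h ν (heavyDeep u s) := by
        refine ENNReal.tsum_le_tsum fun i => ?_
        rw [Measure.prod_prod]
        -- the second tree has to grow `b` generations more than the depth `t + i` of the first
        set b := max s (t + i) - (t + i) with hb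
        have hb' : max s (t + i) = t + i + b := by have := le_max_right s (t + i); omega
        calc markLaw h ν (heavyDeep u 0 ∩ {e | dep e = t + i}) *
              markLaw h ν {e | max s (t + i) ≤ dep e}
            ≤ markLaw h ν (heavyDeep u 0 ∩ {e | dep e = t + i}) *
              (offspringMean h ^ (t + i) * markLaw h ν {e | b ≤ dep e}) := by
              rw [hb']
              gcongr
              exact measure_le_dep_add hreg (t + i) b
          _ = offspringMean h ^ t * offspringMean h ^ i * (markLaw h ν {e | b ≤ dep e} *
              markLaw h ν (heavyDeep u 0 ∩ {e | dep e = t + i})) := by ring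
          _ ≤ offspringMean h ^ t * offspringMean h ^ i * markLaw h ν (heavyDeep u s) := by
              gcongr
              refine (dominated_graft hq hν hreg b (t + i) u 0).trans (measure_mono ?_)
              rintro e ⟨⟨h1, -⟩, h2⟩
              have h2' : t + i + b ≤ dep e := h2
              exact ⟨h1, by have := le_max_left s (t + i); omega⟩
    _ = _ := by
        rw [ENNReal.tsum_mul_right, ENNReal.tsum_mul_left, ENNReal.tsum_geometric]

end Graft

/-! ### The weight of the outgrowth at the root -/

section Growth

/-- The loss `(2 S² Q ^ (S / R + 1)) ^ p` grows more slowly than a given exponential `b ^ S`, if `R` is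
large. -/
theorem exists_polynomial_mul_pow_div_le {b Q : ℝ} (hb : 1 < b) (hQ : 1 ≤ Q) (p : ℕ) :
    ∃ (R : ℕ) (C : ℝ), 0 < R ∧ ∀ S : ℕ, (2 * (S : ℝ) ^ 2 * Q ^ (S / R + 1)) ^ p ≤ C * b ^ S := by
  -- one factor `c` of `b = c * c` absorbs the polynomial, the other one the slow exponential
  set c := √b with hc
  have hc1 : 1 < c := Real.lt_sqrt_of_sq_lt (by simpa using hb)
  have hcc : c * c = b := Real.mul_self_sqrt (by linarith)
  obtain ⟨R, hR⟩ := pow_unbounded_of_one_lt (Q ^ p) hc1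
  have hR0 : 0 < R := by
    refine Nat.pos_of_ne_zero fun h0 => ?_
    rw [h0, pow_zero] at hR
    exact (one_le_pow₀ hQ).not_gt hR
  obtain ⟨B, hB⟩ := (tendsto_pow_const_mul_const_pow_of_lt_one (2 * p) (inv_nonneg.2 (by linarith))
    (inv_lt_one_of_one_lt₀ hc1)).bddAbove_range
  have hB' : ∀ n : ℕ, (n : ℝ) ^ (2 * p) ≤ B * c ^ n := fun n => by
    have := hB ⟨n, rfl⟩
    simp only [inv_pow] at this
    rwa [← div_eq_mul_inv, div_le_iff₀ (by positivity)] at this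
  refine ⟨R, 2 ^ p * Q ^ p * B, hR0, fun S => ?_⟩
  have h1 : (Q ^ p) ^ (S / R) ≤ c ^ S := by
    calc (Q ^ p) ^ (S / R) ≤ (c ^ R) ^ (S / R) := by gcongr
      _ = c ^ (R * (S / R)) := by rw [pow_mul]
      _ ≤ c ^ S := pow_le_pow_right₀ hc1.le (Nat.mul_div_le S R)
  calc (2 * (S : ℝ) ^ 2 * Q ^ (S / R + 1)) ^ p
      = 2 ^ p * Q ^ p * ((S : ℝ) ^ (2 * p) * (Q ^ p) ^ (S / R)) := by ring
    _ ≤ 2 ^ p * Q ^ p * ((B * c ^ S) * c ^ S) := by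
        have h2 := hB' S
        have h3 : 0 ≤ B * c ^ S := le_trans (by positivity) h2
        gcongr
    _ = 2 ^ p * Q ^ p * B * b ^ S := by rw [← hcc, mul_pow]; ring

/-- A quantity bounded by a constant less than `1` and by an exponentially decaying sequence is
bounded by `exp (-c k)`, without a constant in front. -/
theorem exists_exp_mul_min_le {C ρ δ : ℝ} (hρ : 0 ≤ ρ) (hρ1 : ρ < 1) (hδ : 0 < δ) (hδ1 : δ ≤ 1) :
    ∃ c : ℝ, 0 < c ∧ ∀ k : ℕ, Real.exp (c * k) * min (C * ρ ^ k) (1 - δ) ≤ 1 := by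
  obtain ⟨σ, hσ, hσ1⟩ := exists_between hρ1
  have hσ0 : 0 < σ := hρ.trans_lt hσ
  have hlim : Filter.Tendsto (fun k : ℕ => C * (ρ / σ) ^ k) Filter.atTop (nhds (C * 0)) :=
    (tendsto_pow_atTop_nhds_zero_of_lt_one (by positivity)
      ((div_lt_one hσ0).2 hσ)).const_mul C
  rw [mul_zero] at hlim
  obtain ⟨k₀, hk₀⟩ := Filter.eventually_atTop.1 (hlim.eventually_lt_const one_pos)
  have hlog : 0 < -Real.log σ := by linarith [Real.log_neg hσ0 hσ1]
  refine ⟨min (-Real.log σ) (δ / (k₀ + 1)), lt_min hlog (by positivity), fun k => ?_⟩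
  rcases le_or_gt k₀ k with hk | hk
  · have h1 : C * ρ ^ k ≤ σ ^ k := by
      have := (hk₀ k hk).le
      rw [div_pow, ← mul_div_assoc, div_le_one (by positivity)] at this
      exact this
    have h2 : Real.exp (min (-Real.log σ) (δ / (k₀ + 1)) * k) ≤ (σ ^ k)⁻¹ := by
      calc _ ≤ Real.exp (-Real.log σ * k) := by gcongr; exact min_le_left _ _
        _ = (σ ^ k)⁻¹ := by
          rw [neg_mul, Real.exp_neg, mul_comm, Real.exp_nat_mul, Real.exp_log hσ0]
    calc _ ≤ (σ ^ k)⁻¹ * σ ^ k :=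
          mul_le_mul_of_nonneg h2 ((min_le_left _ _).trans h1) (Real.exp_pos _).le (by positivity)
      _ = 1 := inv_mul_cancel₀ (by positivity)
  · have h2 : Real.exp (min (-Real.log σ) (δ / (k₀ + 1)) * k) ≤ Real.exp δ := by
      refine Real.exp_le_exp.2 ?_
      have hk' : (k : ℝ) ≤ k₀ + 1 := by exact_mod_cast (by omega : k ≤ k₀ + 1)
      calc min (-Real.log σ) (δ / (k₀ + 1)) * k ≤ δ / (k₀ + 1) * (k₀ + 1) := by
            gcongr
            exact min_le_right _ _
        _ = δ := div_mul_cancel₀ _ (by positivity)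
    calc _ ≤ Real.exp (min (-Real.log σ) (δ / (k₀ + 1)) * k) * (1 - δ) := by
          gcongr
          exact min_le_right _ _
      _ ≤ Real.exp δ * (1 - δ) := mul_le_mul_of_nonneg_right h2 (by linarith)
      _ ≤ Real.exp δ * Real.exp (-δ) := by
          gcongr
          linarith [Real.add_one_le_exp (-δ)]
      _ = 1 := by rw [← Real.exp_add]; simp

end Growth

section RootOutgrowth

/-- The number of vertices of the outgrowth at the root, if the trees `f` hang from its children and
the path to the base vertex passes through the `j`-th. -/
def sideSize {n : ℕ} (f : Fin n → Marks) (j : Fin n) : ℕ := 1 + ∑ l ∈ Finset.univ.erase j, sz (f l)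

theorem le_sideSize {n : ℕ} (f : Fin n → Marks) (j : Fin n) : n ≤ sideSize f j := by
  have h1 : ∑ _l ∈ Finset.univ.erase j, 1 ≤ ∑ l ∈ Finset.univ.erase j, sz (f l) :=
    Finset.sum_le_sum fun l _ => one_le_sz _
  rw [Finset.sum_const, Finset.card_erase_of_mem (Finset.mem_univ j), Finset.card_univ,
    Fintype.card_fin, smul_eq_mul, mul_one] at h1
  unfold sideSize
  omega

theorem sz_le_sideSize {n : ℕ} (f : Fin n → Marks) {j l : Fin n} (hl : l ≠ j) :
    sz (f l) ≤ sideSize f j := by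
  have := Finset.single_le_sum (f := fun l => sz (f l)) (fun _ _ => Nat.zero_le _)
    (Finset.mem_erase.2 ⟨hl, Finset.mem_univ l⟩)
  unfold sideSize
  omega

theorem sideSize_insertNth {n : ℕ} (j : Fin (n + 1)) (x : Marks) (f : Fin n → Marks) :
    sideSize (j.insertNth x f : Fin (n + 1) → Marks) j = 1 + ∑ l, sz (f l) := by
  have h1 := Finset.add_sum_erase Finset.univ
    (fun l => sz ((j.insertNth x f : Fin (n + 1) → Marks) l)) (Finset.mem_univ j)
  rw [Fin.sum_univ_succAbove _ j] at h1
  simp only [Fin.insertNth_apply_same, Fin.insertNth_apply_succAbove] at h1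
  unfold sideSize
  omega

theorem measurable_sideSize {n : ℕ} (j : Fin n) :
    Measurable fun f : Fin n → Marks => sideSize f j := by
  have h1 : Measurable fun f : Fin n → Marks => ∑ l ∈ Finset.univ.erase j, sz (f l) :=
    Finset.measurable_sum _ fun l _ => measurable_sz.comp (measurable_pi_apply l)
  exact h1.const_add 1

variable {q Q : ℝ} (hq : 1 < q)
include hq

/-- Either the tree of the spine child already carries the weight, up to a factor governed by
the size of the outgrowth at the root, or some tree in this outgrowth carries it and is deep in
comparison with the size of the outgrowth: a shallow tree weighs little. -/
theorem lt_wt_sub_or_exists {e : Marks} (he : Regular q Q e) {n : ℕ} (hn : kids e = n) (j : Fin n)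
    {R : ℕ} (hR : 0 < R) {u : ℝ} (hu : u < wt e) {S : ℕ}
    (hS : S = sideSize (fun l : Fin n => sub (l : ℕ) e) j) :
    u < 2 * (S : ℝ) ^ 2 * Q ^ (S / R + 1) * wt (sub (j : ℕ) e) ∨
      ∃ l : Fin n, j ≠ l ∧ u < (n + 1) * Q * wt (sub (l : ℕ) e) ∧ S ≤ R * dep (sub (l : ℕ) e) := by
  have hQ : 1 ≤ Q := hq.le.trans ((he.2 []).1.trans (he.2 []).2)
  have hsub : ∀ l : Fin n, Regular q Q (sub (l : ℕ) e) := fun l => he.sub (by rw [hn]; exact l.2)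
  have : Nonempty (Fin n) := ⟨j⟩
  obtain ⟨l, hl⟩ := Finite.exists_max fun l : Fin n => wt (sub (l : ℕ) e)
  have hl1 : 1 ≤ wt (sub (l : ℕ) e) := one_le_wt (hsub l) hq.le
  have hj1 : 1 ≤ wt (sub (j : ℕ) e) := one_le_wt (hsub j) hq.le
  have hnS : (n : ℝ) ≤ S := by
    rw [hS]
    exact_mod_cast le_sideSize _ j
  have hn1 : (1 : ℝ) ≤ n := by exact_mod_cast (show 1 ≤ n by have := j.2; omega)
  have hwt : wt e ≤ (n + 1) * Q * wt (sub (l : ℕ) e) := by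
    rw [wt_eq he.1, hn, Finset.sum_range]
    have h1 : ∑ i : Fin n, rootBias (sub (i : ℕ) e) * wt (sub (i : ℕ) e) ≤
        ∑ _i : Fin n, Q * wt (sub (l : ℕ) e) := by
      refine Finset.sum_le_sum fun i _ => ?_
      have h2 : rootBias (sub (i : ℕ) e) ≤ Q := ((hsub i).2 []).2
      exact mul_le_mul h2 (hl i) (by linarith [one_le_wt (hsub i) hq.le]) (by linarith)
    rw [Finset.sum_const, Finset.card_univ, Fintype.card_fin, nsmul_eq_mul] at h1
    have h3 : 1 ≤ Q * wt (sub (l : ℕ) e) := by nlinarith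
    linarith
  have hQp : ∀ k, 1 ≤ Q ^ k := fun k => one_le_pow₀ hQ
  have hS1 : (1 : ℝ) ≤ S := hn1.trans hnS
  by_cases hlj : j = l
  · left
    subst hlj
    refine (hu.trans_le hwt).trans_le ?_
    have h4 : ((n : ℝ) + 1) * Q ≤ 2 * (S : ℝ) ^ 2 * Q ^ (S / R + 1) := by
      rw [pow_succ Q]
      have h5 : (n : ℝ) + 1 ≤ 2 * (S : ℝ) ^ 2 := by nlinarith
      have h6 : Q ≤ Q ^ (S / R) * Q := le_mul_of_one_le_left (by linarith) (hQp _)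
      exact mul_le_mul h5 h6 (by linarith) (by positivity)
    gcongr
  · by_cases hdeep : S ≤ R * dep (sub (l : ℕ) e)
    · exact Or.inr ⟨l, hlj, hu.trans_le hwt, hdeep⟩
    · left
      have hd : dep (sub (l : ℕ) e) ≤ S / R := by
        rw [Nat.le_div_iff_mul_le hR, mul_comm]
        omega
      have hsz : (sz (sub (l : ℕ) e) : ℝ) ≤ S := by
        rw [hS]
        exact_mod_cast sz_le_sideSize (fun l : Fin n => sub (l : ℕ) e) (Ne.symm hlj)
      have h4 : wt (sub (l : ℕ) e) ≤ S * Q ^ (S / R) :=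
        (wt_le (hsub l) hq.le).trans
          (mul_le_mul hsz (pow_le_pow_right₀ hQ hd) (by positivity) (by positivity))
      calc u < (n + 1) * Q * wt (sub (l : ℕ) e) := hu.trans_le hwt
        _ ≤ (2 * S) * Q * (S * Q ^ (S / R)) := by
            refine mul_le_mul ?_ h4 (by linarith) (by positivity)
            refine mul_le_mul_of_nonneg_right (by linarith) (by linarith)
        _ = 2 * (S : ℝ) ^ 2 * Q ^ (S / R + 1) * 1 := by ring
        _ ≤ _ := by gcongr

end RootOutgrowth

section RootOutgrowthLaw

variable {h : PMF ℕ} {ν : Measure ℝ} [IsProbabilityMeasure ν]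

/-- The outgrowth at the root is independent of the tree of the spine child. The exponential moment
of base `B * B` of its size pays for the loss `y S`, with one factor `B`, and leaves the
tail `B⁻¹ ^ k`, with the other. -/
theorem measure_sideSize_le {y : ℕ → ℝ} (hy : ∀ S, 1 ≤ S → 1 ≤ y S) {C₁ C₂ B X : ℝ≥0∞} {p : ℕ}
    (hC₁ : ∀ (z : ℝ) (u : ℝ) (s : ℕ), 1 ≤ z →
      markLaw h ν {e | u < z * wt e ∧ s ≤ dep e + 1} ≤
        C₁ * ENNReal.ofReal z ^ p * markLaw h ν (heavyDeep u s))
    (hC₂ : ∀ S, ENNReal.ofReal (y S) ^ p ≤ C₂ * B ^ S) (hB : 1 ≤ B) (hBt : B ≠ ⊤)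
    (hX : ∫⁻ e, (B * B) ^ sz e ∂markLaw h ν ≤ X) (u : ℝ) (s k : ℕ) {n : ℕ} (j : Fin (n + 1)) :
    Measure.pi (fun _ : Fin (n + 1) => markLaw h ν)
        {f | k ≤ sideSize f j ∧ u < y (sideSize f j) * wt (f j) ∧ s ≤ dep (f j) + 1} ≤
      C₁ * C₂ * (B * B) * X ^ n * B⁻¹ ^ k * markLaw h ν (heavyDeep u s) := by
  have hmp := (measurePreserving_piFinSuccAbove (fun _ : Fin (n + 1) => markLaw h ν) j).symm
  have hm : MeasurableSet {f : Fin (n + 1) → Marks |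
      k ≤ sideSize f j ∧ u < y (sideSize f j) * wt (f j) ∧ s ≤ dep (f j) + 1} := by
    have h1 : Measurable fun f : Fin (n + 1) → Marks => y (sideSize f j) * wt (f j) :=
      ((measurable_of_countable y).comp (measurable_sideSize j)).mul
        (measurable_wt.comp (measurable_pi_apply j))
    have h2 : Measurable fun f : Fin (n + 1) → Marks => dep (f j) + 1 :=
      (measurable_dep.comp (measurable_pi_apply j)).add measurable_const
    exact (measurableSet_le measurable_const (measurable_sideSize j)).inter
      ((measurableSet_lt measurable_const h1).inter (measurableSet_le measurable_const h2))
  have hB0 : B ≠ 0 := (one_pos.trans_le hB).ne'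
  have hG : Measurable fun e => (B * B) ^ sz e :=
    (measurable_of_countable fun k : ℕ => (B * B) ^ k).comp measurable_sz
  rw [← hmp.measure_preimage hm.nullMeasurableSet, Measure.prod_apply_symm (hmp.measurable hm)]
  calc _ ≤ ∫⁻ f : Fin n → Marks, C₁ * C₂ * (B * B) * B⁻¹ ^ k * markLaw h ν (heavyDeep u s) *
          ∏ l, (B * B) ^ sz (f l) ∂Measure.pi fun _ : Fin n => markLaw h ν := by
        refine lintegral_mono fun f => ?_
        set S := 1 + ∑ l, sz (f l) with hS
        have hset : (fun e => (e, f)) ⁻¹' (⇑(MeasurableEquiv.piFinSuccAbove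
            (fun _ : Fin (n + 1) => Marks) j).symm ⁻¹' {f : Fin (n + 1) → Marks |
              k ≤ sideSize f j ∧ u < y (sideSize f j) * wt (f j) ∧ s ≤ dep (f j) + 1}) =
            {e | k ≤ S ∧ u < y S * wt e ∧ s ≤ dep e + 1} := by
          ext e
          have hsp : sideSize (Fin.insertNthEquiv (fun _ => Marks) j (e, f)) j = S :=
            sideSize_insertNth j e f
          have hat : Fin.insertNthEquiv (fun _ => Marks) j (e, f) j = e := by simp
          simp only [Set.mem_preimage, Set.mem_ofPred_eq,
            MeasurableEquiv.piFinSuccAbove_symm_apply, hsp, hat]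
        rw [hset]
        by_cases hk : k ≤ S
        · have h1 : B ^ S ≤ (B * B) ^ S * B⁻¹ ^ k := by
            calc B ^ S = B ^ S * (B ^ k * B⁻¹ ^ k) := by
                  rw [← mul_pow, ENNReal.mul_inv_cancel hB0 hBt, one_pow, mul_one]
              _ ≤ B ^ S * (B ^ S * B⁻¹ ^ k) := by gcongr
              _ = _ := by ring
          have h2 : (B * B) ^ S = (B * B) * ∏ l, (B * B) ^ sz (f l) := by
            rw [hS, pow_add, pow_one, Finset.prod_pow_eq_pow_sum]
          calc markLaw h ν {e | k ≤ S ∧ u < y S * wt e ∧ s ≤ dep e + 1}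
              ≤ markLaw h ν {e | u < y S * wt e ∧ s ≤ dep e + 1} :=
                measure_mono fun e he => he.2
            _ ≤ C₁ * ENNReal.ofReal (y S) ^ p * markLaw h ν (heavyDeep u s) :=
                hC₁ _ _ _ (hy _ (by omega))
            _ ≤ C₁ * (C₂ * ((B * B) ^ S * B⁻¹ ^ k)) * markLaw h ν (heavyDeep u s) := by
                gcongr
                exact (hC₂ S).trans (mul_le_mul_right h1 _)
            _ = _ := by rw [h2]; ring
        · simp [hk]
    _ = C₁ * C₂ * (B * B) * B⁻¹ ^ k * markLaw h ν (heavyDeep u s) *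
          (∫⁻ e, (B * B) ^ sz e ∂markLaw h ν) ^ n := by
        have hP : Measurable fun f : Fin n → Marks => ∏ l, (B * B) ^ sz (f l) :=
          Finset.measurable_prod _ fun l _ => hG.comp (measurable_pi_apply l)
        rw [lintegral_const_mul _ hP, lintegral_pi_prod h ν hG]
    _ ≤ C₁ * C₂ * (B * B) * B⁻¹ ^ k * markLaw h ν (heavyDeep u s) * X ^ n := by gcongr
    _ = _ := by ring

end RootOutgrowthLaw

/-! ### Tails of the outgrowths -/

section RootOutgrowthTail

variable {h : PMF ℕ} {ν : Measure ℝ} [IsProbabilityMeasure ν] {q Q : ℝ}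

/-- The contribution of a given number of children to the tail of the outgrowth at the root. The two
terms correspond to the alternative in `lt_wt_sub_or_exists`. -/
theorem measure_kids_og_zero_le (hq : 1 < q) (hν : ∀ᵐ x ∂ν, q ≤ x ∧ x ≤ Q)
    (hreg : ∀ᵐ e ∂markLaw h ν, Regular q Q e) (hQ : 1 ≤ Q)
    {R : ℕ} (hR : 0 < R) {C₁ C₂ B X : ℝ≥0∞} {p : ℕ}
    (hC₁ : ∀ (z : ℝ) (u : ℝ) (s : ℕ), 1 ≤ z →
      markLaw h ν {e | u < z * wt e ∧ s ≤ dep e + 1} ≤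
        C₁ * ENNReal.ofReal z ^ p * markLaw h ν (heavyDeep u s))
    (hC₂ : ∀ S : ℕ, ENNReal.ofReal (2 * (S : ℝ) ^ 2 * Q ^ (S / R + 1)) ^ p ≤ C₂ * B ^ S)
    (hB : 1 ≤ B) (hBt : B ≠ ⊤) (hX1 : 1 ≤ X)
    (hX : ∫⁻ e, (B * B) ^ sz e ∂markLaw h ν ≤ X) (u : ℝ) (s : ℕ) {k t : ℕ} (hk : 2 ≤ k)
    (ht : ∀ d, k ≤ R * d → t ≤ d) (n : ℕ) :
    markLaw h ν {e | kids e = n ∧ e ∈ heavyDeep u s ∩ {e | k ≤ og 0 e}} ≤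
      C₁ * C₂ * (B * B) * (n * h n * X ^ n) * B⁻¹ ^ k * markLaw h ν (heavyDeep u s) +
      (1 - offspringMean h)⁻¹ * C₁ * (ENNReal.ofReal (2 * Q)) ^ p * (n ^ (p + 2) * h n) *
        offspringMean h ^ t * markLaw h ν (heavyDeep u s) := by
  set P := markLaw h ν with hP
  set y : ℕ → ℝ := fun S => 2 * (S : ℝ) ^ 2 * Q ^ (S / R + 1) with hy
  have hy1 : ∀ S, 1 ≤ S → 1 ≤ y S := fun S hS => by
    have h1 : (1 : ℝ) ≤ S := by exact_mod_cast hS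
    have h2 : 1 ≤ Q ^ (S / R + 1) := one_le_pow₀ hQ
    have h3 : 1 ≤ 2 * (S : ℝ) ^ 2 := by nlinarith
    exact one_le_mul_of_one_le_of_one_le h3 h2
  let A : Fin n → Set (Fin n → Marks) := fun j =>
    {f | k ≤ sideSize f j ∧ u < y (sideSize f j) * wt (f j) ∧ s ≤ dep (f j) + 1}
  let D : Set (Marks × Marks) :=
    {x | u / ((n + 1) * Q) < wt x.1 ∧ t ≤ dep x.1 ∧ max (s - 1) (dep x.1) ≤ dep x.2}
  have hAm : ∀ j, MeasurableSet (A j) := fun j => by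
    have h1 : Measurable fun f : Fin n → Marks => y (sideSize f j) * wt (f j) :=
      ((measurable_of_countable y).comp (measurable_sideSize j)).mul
        (measurable_wt.comp (measurable_pi_apply j))
    have h2 : Measurable fun f : Fin n → Marks => dep (f j) + 1 :=
      (measurable_dep.comp (measurable_pi_apply j)).add measurable_const
    exact (measurableSet_le measurable_const (measurable_sideSize j)).inter
      ((measurableSet_lt measurable_const h1).inter (measurableSet_le measurable_const h2))
  have hDm : MeasurableSet D := by
    have h1 : Measurable fun x : Marks × Marks => dep x.1 := measurable_dep.comp measurable_fst
    have h2 : Measurable fun x : Marks × Marks => dep x.2 := measurable_dep.comp measurable_snd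
    exact (measurableSet_lt measurable_const (measurable_wt.comp measurable_fst)).inter
      ((measurableSet_le measurable_const h1).inter
        (measurableSet_le (measurable_const.max h1) h2))
  have hnQ : 0 < ((n : ℝ) + 1) * Q := by positivity
  have hcover : P {e | kids e = n ∧ e ∈ heavyDeep u s ∩ {e | k ≤ og 0 e}} ≤
      P ((⋃ j : Fin n, {e | kids e = n ∧ (fun l : Fin n => sub (l : ℕ) e) ∈ A j}) ∪
        ⋃ j : Fin n, ⋃ l : Fin n, {e | l ≠ j ∧ kids e = n ∧
          (sub (l : ℕ) e, sub (j : ℕ) e) ∈ D}) := by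
    refine measure_mono_ae ?_
    filter_upwards [hreg] with e he
    rintro ⟨hkn, ⟨hu, hs⟩, hog⟩
    have hog' : k ≤ og 0 e := hog
    have hn : 0 < n := by
      refine Nat.pos_of_ne_zero fun h0 => ?_
      have h1 := og_le_sz 0 e
      rw [sz_eq_one_of_kids he.1 (by omega)] at h1
      omega
    obtain ⟨j, hj⟩ := exists_isSpine hn fun l : Fin n => sub (l : ℕ) e
    have hkS : k ≤ sideSize (fun l : Fin n => sub (l : ℕ) e) j :=
      hog'.trans (og_zero_of_isSpine he.1 hkn hj)
    have hdep := dep_eq_of_isSpine he.1 hkn hj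
    rcases lt_wt_sub_or_exists hq he hkn j hR hu rfl with h1 | ⟨l, hjl, h1, h2⟩
    · exact Or.inl (Set.mem_iUnion.2 ⟨j, hkn, hkS, h1, hdep ▸ hs⟩)
    · refine Or.inr (Set.mem_iUnion.2 ⟨j, Set.mem_iUnion.2 ⟨l, hjl.symm, hkn, ?_, ?_, ?_⟩⟩)
      · simp only
        rwa [div_lt_iff₀ hnQ, mul_comm]
      · exact ht _ (hkS.trans h2)
      · exact max_le (by simp only; omega) (hj.2 l)
  have hfirst : ∀ j : Fin n, P {e | kids e = n ∧ (fun l : Fin n => sub (l : ℕ) e) ∈ A j} ≤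
      h n * (C₁ * C₂ * (B * B) * X ^ n * B⁻¹ ^ k * P (heavyDeep u s)) := by
    intro j
    rw [measure_kids_eq_inter h ν n (hAm j)]
    gcongr
    obtain ⟨n', rfl⟩ : ∃ i, n = i + 1 := ⟨n - 1, by have := j.2; omega⟩
    refine (measure_sideSize_le hy1 hC₁ hC₂ hB hBt hX u s k j).trans ?_
    gcongr
    exact Nat.le_succ n'
  have hsecond : ∀ j l : Fin n, P {e | l ≠ j ∧ kids e = n ∧
      (sub (l : ℕ) e, sub (j : ℕ) e) ∈ D} ≤
      h n * (offspringMean h ^ t * (1 - offspringMean h)⁻¹ *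
        (C₁ * (ENNReal.ofReal (2 * Q) ^ p * n ^ p) * P (heavyDeep u s))) := by
    intro j l
    by_cases hlj : l = j
    · simp [hlj]
    simp only [ne_eq, hlj, not_false_eq_true, true_and]
    rw [measure_kids_eq_sub_sub h ν hlj hDm]
    gcongr
    refine (measure_two_trees_le hq hν hreg _ _ _).trans ?_
    gcongr
    have h1 : heavyDeep (u / ((n + 1) * Q)) (s - 1) =
        {e | u < ((n + 1) * Q) * wt e ∧ s ≤ dep e + 1} := by
      ext e
      simp only [heavyDeep, Set.mem_ofPred_eq, div_lt_iff₀ hnQ, mul_comm (wt e)]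
      exact and_congr_right fun _ => by omega
    rw [h1]
    have hn1 : (1 : ℝ) ≤ n := by exact_mod_cast (show 1 ≤ n by have := j.2; omega)
    refine (hC₁ _ u s (by nlinarith)).trans ?_
    gcongr
    rw [← mul_pow]
    gcongr
    rw [← ENNReal.ofReal_natCast n, ← ENNReal.ofReal_mul (by linarith)]
    exact ENNReal.ofReal_le_ofReal (by nlinarith)
  refine hcover.trans ((measure_union_le _ _).trans (add_le_add ?_ ?_))
  · refine (measure_iUnion_fintype_le _ _).trans ((Finset.sum_le_sum fun j _ => hfirst j).trans ?_)
    simp only [Finset.sum_const, Finset.card_univ, Fintype.card_fin, nsmul_eq_mul]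
    exact le_of_eq (by ring)
  · refine (measure_iUnion_fintype_le _ _).trans ((Finset.sum_le_sum fun j _ =>
      (measure_iUnion_fintype_le _ _).trans (Finset.sum_le_sum fun l _ => hsecond j l)).trans ?_)
    simp only [Finset.sum_const, Finset.card_univ, Fintype.card_fin, nsmul_eq_mul]
    exact le_of_eq (by ring)

/-- Conditionally on `{ω(T) > u, D(T) ≥ s}`, the outgrowth at the root has an exponential tail,
uniformly in `u` and `s`. -/
theorem exists_measure_og_zero_le (hh : SubcriticalExpTail h) (hq : 1 < q)
    (hν : ∀ᵐ x ∂ν, q ≤ x ∧ x ≤ Q) (hreg : ∀ᵐ e ∂markLaw h ν, Regular q Q e)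
    {m : ℕ} (hm : 1 ≤ m) (hhm : h m ≠ 0) (hh0 : h 0 ≠ 0) :
    ∃ C ρ : ℝ≥0∞, C ≠ ⊤ ∧ ρ < 1 ∧ ∀ u s k, 2 ≤ k →
      markLaw h ν (heavyDeep u s ∩ {e | k ≤ og 0 e}) ≤ C * ρ ^ k * markLaw h ν (heavyDeep u s) := by
  obtain ⟨r, hr0, hr1, hr⟩ := hh.exists_geometric
  obtain ⟨a, x, ha, hx, hax, hder⟩ := hh.exists_tilt
  obtain ⟨C₁, p, hC₁t, hC₁⟩ := exists_measure_mul_wt_le hq hreg hm hhm hh0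
  have hQ : 1 ≤ Q := by
    obtain ⟨x, hx⟩ := hν.exists
    linarith [hx.1, hx.2]
  set b := √a with hb
  have hb1 : 1 < b := Real.lt_sqrt_of_sq_lt (by simpa using ha)
  obtain ⟨R, C₂, hR, hC₂⟩ := exists_polynomial_mul_pow_div_le hb1 hQ p
  set B := ENNReal.ofReal b with hBdef
  have hB1 : 1 < B := by
    rw [← ENNReal.ofReal_one]
    exact (ENNReal.ofReal_lt_ofReal_iff (by linarith)).2 hb1
  have hBB : B * B = ENNReal.ofReal a := by
    rw [← ENNReal.ofReal_mul (by linarith), hb, Real.mul_self_sqrt (by linarith)]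
  set X := ENNReal.ofReal x with hXdef
  have hX1 : 1 ≤ X := ENNReal.one_le_ofReal.2 hx.le
  have hX : ∫⁻ e, (B * B) ^ sz e ∂markLaw h ν ≤ X := by
    rw [hBB]
    exact lintegral_pow_sz_le h ν ha hx hax
  have hC₂' : ∀ S : ℕ, ENNReal.ofReal (2 * (S : ℝ) ^ 2 * Q ^ (S / R + 1)) ^ p ≤
      ENNReal.ofReal C₂ * B ^ S := fun S => by
    rw [← ENNReal.ofReal_pow (by positivity), hBdef, ← ENNReal.ofReal_pow (by linarith),
      ← ENNReal.ofReal_mul' (by positivity)]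
    exact ENNReal.ofReal_le_ofReal (hC₂ S)
  set l := offspringMean h with hl
  have hl1 : l < 1 := hh.mean_lt_one
  -- depth at least `k / R` costs `l ^ (k / R) = σ ^ k`
  set σ := l ^ ((R : ℝ)⁻¹) with hσ
  have hσ1 : σ < 1 := ENNReal.rpow_lt_one hl1 (by positivity)
  have hσR : σ ^ R = l := ENNReal.rpow_inv_natCast_pow hR.ne' l
  set M₁ := ∑' n : ℕ, (n : ℝ≥0∞) * h n * X ^ n with hM₁
  set M₂ := ∑' n : ℕ, (n : ℝ≥0∞) ^ (p + 2) * h n with hM₂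
  have hM₂t : M₂ < ⊤ := by
    have := tsum_pow_mul_lt_top hr0 hr zero_le_one (by linarith) (p + 2)
    simpa using this
  set K₁ := C₁ * ENNReal.ofReal C₂ * (B * B) with hK₁
  set K₂ := (1 - l)⁻¹ * C₁ * (ENNReal.ofReal (2 * Q)) ^ p with hK₂
  have hK₁t : K₁ ≠ ⊤ := ENNReal.mul_ne_top (ENNReal.mul_ne_top hC₁t ENNReal.ofReal_ne_top)
    (ENNReal.mul_ne_top ENNReal.ofReal_ne_top ENNReal.ofReal_ne_top)
  have hK₂t : K₂ ≠ ⊤ := ENNReal.mul_ne_top (ENNReal.mul_ne_top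
    (ENNReal.inv_ne_top.2 (tsub_pos_of_lt hl1).ne') hC₁t) (ENNReal.pow_ne_top ENNReal.ofReal_ne_top)
  refine ⟨K₁ * M₁ + K₂ * M₂, max B⁻¹ σ, ENNReal.add_ne_top.2
    ⟨ENNReal.mul_ne_top hK₁t hder.ne, ENNReal.mul_ne_top hK₂t hM₂t.ne⟩,
    max_lt (ENNReal.inv_lt_one.2 hB1) hσ1, fun u s k hk => ?_⟩
  -- `t` is `k / R` rounded upwards
  set t := (k + R - 1) / R with ht
  have htd : ∀ d, k ≤ R * d → t ≤ d := fun d hd => by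
    rw [ht, ← Nat.lt_succ_iff, Nat.div_lt_iff_lt_mul hR, Nat.succ_mul, mul_comm]
    omega
  have hkt : k ≤ R * t := by
    have h1 := Nat.div_add_mod (k + R - 1) R
    have h2 := Nat.mod_lt (k + R - 1) hR
    rw [← ht] at h1
    omega
  have hmk : MeasurableSet (heavyDeep u s ∩ {e | k ≤ og 0 e}) :=
    (measurableSet_heavyDeep u s).inter (measurableSet_le measurable_const (measurable_og 0))
  have hlt : l ^ t ≤ max B⁻¹ σ ^ k := by
    rw [← hσR, ← pow_mul]
    exact (pow_le_pow_right_of_le_one' hσ1.le hkt).trans (pow_le_pow_left' (le_max_right _ _) k)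
  have hBk : B⁻¹ ^ k ≤ max B⁻¹ σ ^ k := pow_le_pow_left' (le_max_left _ _) k
  rw [measure_eq_tsum_kids _ hmk]
  calc _ ≤ ∑' n : ℕ, (K₁ * (n * h n * X ^ n) * B⁻¹ ^ k * markLaw h ν (heavyDeep u s) +
          K₂ * (n ^ (p + 2) * h n) * l ^ t * markLaw h ν (heavyDeep u s)) :=
        ENNReal.tsum_le_tsum fun n => measure_kids_og_zero_le hq hν hreg hQ hR hC₁ hC₂' hB1.le
          ENNReal.ofReal_ne_top hX1 hX u s hk htd n
    _ = K₁ * M₁ * B⁻¹ ^ k * markLaw h ν (heavyDeep u s) +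
          K₂ * M₂ * l ^ t * markLaw h ν (heavyDeep u s) := by
        rw [ENNReal.tsum_add]
        simp only [ENNReal.tsum_mul_right, ENNReal.tsum_mul_left]
        rfl
    _ ≤ K₁ * M₁ * max B⁻¹ σ ^ k * markLaw h ν (heavyDeep u s) +
          K₂ * M₂ * max B⁻¹ σ ^ k * markLaw h ν (heavyDeep u s) := by
        exact add_le_add (mul_le_mul_left (mul_le_mul_right hBk _) _)
          (mul_le_mul_left (mul_le_mul_right hlt _) _)
    _ = _ := by ring

end RootOutgrowthTail

section AllOutgrowths

variable {h : PMF ℕ} {ν : Measure ℝ} [IsProbabilityMeasure ν] {q Q : ℝ}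

theorem vertsDetermined_og (i k : ℕ) : VertsDetermined {e | k ≤ og i e} := fun e e' he => by
  simp only [Set.mem_ofPred_eq, og_congr i he]

/-- The uniform bound `exp (-c k)` for the outgrowth at the root. For small `k` it comes from
planting the tree above a new root, which forces an outgrowth of at most `m` vertices. -/
theorem exists_dominated_og_zero (hh : SubcriticalExpTail h) (hq : 1 < q)
    (hν : ∀ᵐ x ∂ν, q ≤ x ∧ x ≤ Q) (hreg : ∀ᵐ e ∂markLaw h ν, Regular q Q e)
    {m : ℕ} (hm : 1 ≤ m) (hhm : h m ≠ 0) (hh0 : h 0 ≠ 0) :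
    ∃ c : ℝ, 0 < c ∧ ∀ k, m < k →
      Dominated (markLaw h ν) (ENNReal.ofReal (Real.exp (c * k))) {e | k ≤ og 0 e} Set.univ := by
  obtain ⟨C, ρ, hC, hρ, htail⟩ := exists_measure_og_zero_le hh hq hν hreg hm hhm hh0
  set δ := h m * h 0 ^ (m - 1) with hδ
  have hδ0 : δ ≠ 0 := mul_ne_zero hhm (pow_ne_zero _ hh0)
  have hδ1 : δ ≤ 1 := mul_le_one' (h.coe_le_one m) (pow_le_one' (h.coe_le_one 0) _)
  have hδt : δ ≠ ⊤ := (hδ1.trans_lt ENNReal.one_lt_top).ne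
  have hρr : ρ.toReal < 1 := by
    rw [← ENNReal.toReal_one]
    exact ENNReal.toReal_strict_mono ENNReal.one_ne_top hρ
  have hδr : δ.toReal ≤ 1 := by
    rw [← ENNReal.toReal_one]
    exact ENNReal.toReal_mono ENNReal.one_ne_top hδ1
  obtain ⟨c, hc, hcmin⟩ := exists_exp_mul_min_le (C := C.toReal) ENNReal.toReal_nonneg hρr
    (ENNReal.toReal_pos hδ0 hδt) hδr
  refine ⟨c, hc, fun k hk u s => ?_⟩
  rw [Set.inter_univ]
  set F := markLaw h ν (heavyDeep u s) with hF
  have hFt : F ≠ ⊤ := measure_ne_top _ _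
  have h1 : markLaw h ν (heavyDeep u s ∩ {e | k ≤ og 0 e}) ≤
      ENNReal.ofReal (C.toReal * ρ.toReal ^ k) * F := by
    rw [ENNReal.ofReal_mul ENNReal.toReal_nonneg, ENNReal.ofReal_pow ENNReal.toReal_nonneg,
      ENNReal.ofReal_toReal hC, ENNReal.ofReal_toReal (hρ.trans ENNReal.one_lt_top).ne]
    exact htail u s k (by omega)
  have h2 : markLaw h ν (heavyDeep u s ∩ {e | k ≤ og 0 e}) ≤
      ENNReal.ofReal (1 - δ.toReal) * F := by
    have hplant : δ * F ≤ markLaw h ν (heavyDeep u s ∩ {e | k ≤ og 0 e}ᶜ) := by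
      calc δ * F ≤ δ * markLaw h ν {e | u < q * wt e ∧ s ≤ dep e} := by
            gcongr
            refine measure_mono_ae ?_
            filter_upwards [hreg] with e he
            rintro ⟨hu, hs⟩
            have := one_le_wt he hq.le
            exact ⟨hu.trans_le (le_mul_of_one_le_left (by linarith) hq.le), hs⟩
        _ ≤ markLaw h ν (heavyDeep u (s + 1) ∩ {e | og 0 e ≤ m}) := measure_plant_le hq hreg hm u s
        _ ≤ _ := by
            refine measure_mono ?_
            rintro e ⟨⟨hu, hs⟩, ho⟩
            have ho' : og 0 e ≤ m := ho
            refine ⟨⟨hu, by omega⟩, fun hk' => ?_⟩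
            have hk'' : k ≤ og 0 e := hk'
            omega
    have hsplit := measure_inter_add_sdiff (μ := markLaw h ν) (heavyDeep u s)
      (vertsDetermined_og 0 k).measurableSet
    rw [Set.sdiff_eq] at hsplit
    have hsub : ENNReal.ofReal (1 - δ.toReal) * F = F - δ * F := by
      rw [ENNReal.ofReal_sub _ ENNReal.toReal_nonneg, ENNReal.ofReal_toReal hδt,
        ENNReal.ofReal_one, ENNReal.sub_mul fun _ _ => hFt, one_mul]
    rw [hsub]
    refine ENNReal.le_sub_of_add_le_right (ENNReal.mul_ne_top hδt hFt) ?_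
    rw [← hF] at hsplit
    exact (add_le_add le_rfl hplant).trans_eq hsplit
  have h3 : markLaw h ν (heavyDeep u s ∩ {e | k ≤ og 0 e}) ≤
      ENNReal.ofReal (min (C.toReal * ρ.toReal ^ k) (1 - δ.toReal)) * F := by
    rcases min_choice (C.toReal * ρ.toReal ^ k) (1 - δ.toReal) with h | h <;> rw [h]
    · exact h1
    · exact h2
  calc ENNReal.ofReal (Real.exp (c * k)) * markLaw h ν (heavyDeep u s ∩ {e | k ≤ og 0 e})
      ≤ ENNReal.ofReal (Real.exp (c * k)) *
          (ENNReal.ofReal (min (C.toReal * ρ.toReal ^ k) (1 - δ.toReal)) * F) := by gcongr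
    _ = ENNReal.ofReal (Real.exp (c * k) * min (C.toReal * ρ.toReal ^ k) (1 - δ.toReal)) * F := by
        rw [ENNReal.ofReal_mul (Real.exp_pos _).le, mul_assoc]
    _ ≤ 1 * F := by
        gcongr
        rw [← ENNReal.ofReal_one]
        exact ENNReal.ofReal_le_ofReal (hcmin k)
    _ = F := one_mul F

/-- The bound for the outgrowth at the root passes to all outgrowths, since the `(i+1)`-st outgrowth
is the `i`-th outgrowth of the tree of the spine child. -/
theorem dominated_og (hν : ∀ᵐ x ∂ν, 0 < x) (hreg : ∀ᵐ e ∂markLaw h ν, Regular q Q e)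
    {c : ℝ≥0∞} {k : ℕ} (hk : 0 < k) (h0 : Dominated (markLaw h ν) c {e | k ≤ og 0 e} Set.univ)
    (i : ℕ) : Dominated (markLaw h ν) c {e | k ≤ og i e} Set.univ := by
  have huniv : VertsDetermined Set.univ := fun _ _ _ => Iff.rfl
  induction i with
  | zero => exact h0
  | succ i ih =>
    refine ih.of_spine_child hν hreg (vertsDetermined_og i k) huniv (vertsDetermined_og _ k) huniv
      ?_ ?_ fun _ _ _ _ _ => trivial
    · intro e he hkids hmem
      have hmem' : k ≤ og (i + 1) e := hmem
      rw [og_eq_zero_of_lt (by rw [dep_eq_zero he hkids]; omega)] at hmem'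
      omega
    · intro e he j hj hmem
      exact le_trans (show k ≤ og (i + 1) e from hmem) (og_succ_of_isSpine he rfl hj i)

end AllOutgrowths

section TwoFamilies

variable (h : PMF ℕ) (ν : Measure ℝ) [IsProbabilityMeasure ν]

/-- The marks made of a family of numbers of children and a family of biases. -/
def zipMarks (e : (Label → ℕ) × (Label → ℝ)) : Marks := fun v => (e.1 v, e.2 v)

theorem measurePreserving_zipMarks : MeasurePreserving zipMarks (gwLaw h ν) (markLaw h ν) := by
  have hm : Measurable zipMarks := by
    unfold zipMarks
    fun_prop
  refine ⟨hm, ?_⟩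
  have hu := measurePreserving_unzip (ι := Label) h.toMeasure ν
  rw [gwLaw, ← hu.map_eq, Measure.map_map hm hu.measurable]
  exact Measure.map_id

variable {h}

theorem SubcriticalExpTail.apply_zero_ne_zero (hh : SubcriticalExpTail h) : h 0 ≠ 0 := by
  intro h0
  refine hh.mean_lt_one.not_ge ?_
  rw [← h.tsum_coe]
  refine ENNReal.tsum_le_tsum fun n => ?_
  cases n with
  | zero => simp [h0]
  | succ n => exact le_mul_of_one_le_left' (by simp)

end TwoFamilies

end

theorem theorem6 (h : PMF ℕ) (hh : SubcriticalExpTail h)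
    (ν : Measure ℝ) [IsProbabilityMeasure ν]
    (hν_compact : IsCompact ν.support) (hν_gt_one : ν.support ⊆ Set.Ioi 1) :
    ∃ c : ℝ, 0 < c ∧ ∀ u : ℝ, 0 < u → ∀ i k : ℕ,
      (∃ j : ℕ, 1 ≤ j ∧ j < k ∧ h j ≠ 0) →
        (gwCondLaw h ν u).real {e | k ≤ ((gwTree e).outgrowth i).card} ≤ Real.exp (-c * k) := by
  by_cases hex : ∃ j, 1 ≤ j ∧ h j ≠ 0
  swap
  · exact ⟨1, one_pos, fun u _ i k ⟨j, hj1, _, hj⟩ => absurd ⟨j, hj1, hj⟩ hex⟩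
  obtain ⟨hm, hhm⟩ := Nat.find_spec hex
  set m := Nat.find hex with hmdef
  have hne : ν.support.Nonempty :=
    Measure.nonempty_support (IsProbabilityMeasure.ne_zero ν)
  -- `q` and `Q` are the least and the greatest element of the support
  obtain ⟨q, hqmem, hqle⟩ := hν_compact.exists_isLeast hne
  obtain ⟨Q, -, hQle⟩ := hν_compact.exists_isGreatest hne
  have hq : 1 < q := hν_gt_one hqmem
  have hν : ∀ᵐ x ∂ν, q ≤ x ∧ x ≤ Q := by
    filter_upwards [Measure.support_mem_ae (μ := ν)] with x hx
    exact ⟨hqle hx, hQle hx⟩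
  have hν0 : ∀ᵐ x ∂ν, 0 < x := by
    filter_upwards [hν] with x hx
    linarith [hx.1]
  obtain ⟨a, x, ha, hx, hax, -⟩ := hh.exists_tilt
  have hreg : ∀ᵐ e ∂markLaw h ν, Regular q Q e := by
    filter_upwards [ae_finite_markVerts h ν ha hx hax, ae_bias h ν hν] with e h1 h2
    exact ⟨h1, h2⟩
  obtain ⟨c, hc, hdom⟩ := exists_dominated_og_zero hh hq hν hreg hm hhm hh.apply_zero_ne_zero
  refine ⟨c, hc, fun u _ i k ⟨j, hj1, hjk, hj⟩ => ?_⟩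
  have hmk : m < k := (Nat.find_min' hex ⟨hj1, hj⟩).trans_lt hjk
  have hz := measurePreserving_zipMarks h ν
  -- with `s = 0` the condition on the depth is void
  have hbound := dominated_og hν0 hreg (by omega) (hdom k hmk) i u 0
  rw [Set.inter_univ] at hbound
  set F := markLaw h ν (heavyDeep u 0) with hF
  have hpre : {e | u < (gwTree e).weight} = zipMarks ⁻¹' heavyDeep u 0 := by
    ext e
    exact ⟨fun h => ⟨h, Nat.zero_le _⟩, fun h => h.1⟩
  have hmeas : MeasurableSet {e | u < (gwTree e).weight} := by
    rw [hpre]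
    exact hz.measurable (measurableSet_heavyDeep u 0)
  have hF' : gwLaw h ν {e | u < (gwTree e).weight} = F := by
    rw [hpre, hz.measure_preimage (measurableSet_heavyDeep u 0).nullMeasurableSet]
  have hG : gwLaw h ν ({e | u < (gwTree e).weight} ∩
      {e | k ≤ ((gwTree e).outgrowth i).card}) ≤
      markLaw h ν (heavyDeep u 0 ∩ {e | k ≤ og i e}) := by
    rw [← hz.measure_preimage ((measurableSet_heavyDeep u 0).inter
      (vertsDetermined_og i k).measurableSet).nullMeasurableSet, hpre]
    refine measure_mono fun e he => ⟨he.1, ?_⟩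
    exact le_trans (show k ≤ ((gwTree e).outgrowth i).card from he.2)
      (Finset.card_le_card ((gwTree e).outgrowth_subset_side i))
  have hexp : ENNReal.ofReal (Real.exp (-c * k)) * ENNReal.ofReal (Real.exp (c * k)) = 1 := by
    rw [← ENNReal.ofReal_mul (Real.exp_pos _).le, ← Real.exp_add]
    simp
  have hfin : gwCondLaw h ν u {e | k ≤ ((gwTree e).outgrowth i).card} ≤
      ENNReal.ofReal (Real.exp (-c * k)) := by
    rw [gwCondLaw, ProbabilityTheory.cond_apply hmeas, hF']
    calc F⁻¹ * gwLaw h ν ({e | u < (gwTree e).weight} ∩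
          {e | k ≤ ((gwTree e).outgrowth i).card})
        ≤ F⁻¹ * (ENNReal.ofReal (Real.exp (-c * k)) * F) := by
          gcongr
          calc _ ≤ markLaw h ν (heavyDeep u 0 ∩ {e | k ≤ og i e}) := hG
            _ = ENNReal.ofReal (Real.exp (-c * k)) * (ENNReal.ofReal (Real.exp (c * k)) *
                markLaw h ν (heavyDeep u 0 ∩ {e | k ≤ og i e})) := by
              rw [← mul_assoc, hexp, one_mul]
            _ ≤ _ := by gcongr
      _ = ENNReal.ofReal (Real.exp (-c * k)) * (F⁻¹ * F) := by ring
      _ ≤ ENNReal.ofReal (Real.exp (-c * k)) * 1 := by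
          gcongr
          exact ENNReal.inv_mul_le_one F
      _ = _ := mul_one _
  exact ENNReal.toReal_le_of_le_ofReal (Real.exp_pos _).le hfin
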